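/- Pauli operators are taken modulo phases. A subsystem code on a finite set of qubits is given by a family of gauge checks (Pauli operators) generating a gauge group $\mathcal G$; a stabilizer code is the case of commuting checks. Let $N(\mathcal G)$ be the group of Pauli operators commuting with $\mathcal G$. The number $k$ of logical qubits is defined by $|N(\mathcal G)/(N(\mathcal G)\cap\mathcal G)|=4^k$, and the distance $d$ is the least weight of an element of $(N(\mathcal G)\cdot\mathcal G)\setminus\mathcal G$ ($d=\infty$ if $k=0$). The degree of a qubit is the number of checks of weight at least two acting on it. A code with qubits placed at sites of $\mathbb Z^D$ is local with density $\rho$ if every site holds at most $\rho$ qubits and any two qubits in the support of one check are at equal or neighbouring sites. Wire codes. Let $\mathcal C_{\rm in}$ be a stabilizer code on $n$ qubits given by $r$ commuting non-identity checks, each of weight at most $\omega$, with each qubit in the support of at most $\delta$ checks. Let $D\ge 3$ and let $c\geq 1$ be an integer. Put $m=\lceil \max(n,r)^{1/(D-1)}\rceil$. A run of the $D$-dimensional wire code construction with constant $c$ consists of (a) distinct sites of $[m]^{D-1}\times\{0\}$ for the qubits and distinct sites of $[m]^{D-1}\times\{cm\}$ for the checks; (b) a partition of the pairs $(q,s)$,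 with $q$ in the support of $s$, into at most $\omega\delta+1$ classes such that no two distinct pairs in a class share a qubit or a check; (c) for each pair $(q,s)$ a lattice path $a_0,\dots,a_T$ inside $[m]^{D-1}\times\{0,\dots,cm\}$ from the site of $q$ to the site of $s$, such that the paths of any one class are edge-disjoint. The wire code $\mathcal C_{\rm wire}$ of the run has the following qubits: the $n$ data qubits; for each qubit $q$ and each $P\in\{X,Y,Z\}$ one copy qubit for every check $s$ acting on $q$ by $P$ (placed at the site of $q$); for every pair a wire qubit at each vertex of its path; and for every check $s$ one link qubit between consecutive elements of its support (placed at the site of $s$). Its gauge checks are (1) for each $q$ and $P$, with copy qubits $r_1,\dots,r_\ell$ ($\ell\ge1$, in the order of the checks): $P_qZ_{r_1}$ and $Z_{r_i}Z_{r_{i+1}}$ for $1\le i<\ell$; (2) for each pair $(q,s)$ with copy qubit $r$ and path $a_0,\dots,a_T$: $Z_{r}Z_{a_0}$ and $Z_{a_{t-1}}Z_{a_t}$ for $1\le t\le T$; (3) for each check $s$ with support $q_1<\dots<q_p$, final wire qubits $e_1,\dots,e_p$ of the paths of the pairs $(q_i,s)$, and link qubits $b_1,\dots,b_{p-1}$: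 $Z_{e_i}Z_{b_{i-1}}Z_{b_i}$ for $1\le i\le p$, with $b_0$ and $b_p$ omitted; (4) the single-qubit operator $X$ on every copy, wire and link qubit. Theorem. For every $D\ge 3$ there is an integer $c_D\ge1$ such that for all $\omega,\delta$ there are constants $A,B,\rho$ depending only on $D,\omega,\delta$ with the following property. For every stabilizer code $\mathcal C_{\rm in}$ on $n_{\rm in}$ qubits, given by non-identity checks of weight at most $\omega$ with each qubit in the support of at most $\delta$ checks, with $k_{\rm in}$ logical qubits and distance $d_{\rm in}$, a run of the $D$-dimensional wire code construction with constant $c_D$ exists, and for every such run the wire code $\mathcal C_{\rm wire}$ satisfies: 1. $n_{\rm wire}\le A\,c_D\,n_{\rm in}^{D/(D-1)}$; 2. $k_{\rm wire}=k_{\rm in}$; 3. $d_{\rm in}\le B\,d_{\rm wire}$, i.e. $d_{\rm wire}\ge\Omega(d_{\rm in})$; 4. $\mathcal C_{\rm wire}$ is local in $\mathbb Z^D$ with density $\rho$, for the placement described above; 5. every gauge check has weight at most three and every qubit has degree at most three. -/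

import Mathlib

noncomputable section

namespace WireCode

/-! ### Pauli operators and subsystem codes

Pauli operators are taken modulo phases: an operator on the qubits `Q` assigns to every qubit
a pair `(x, z)` of bits, where `(0, 0)`, `(1, 0)`, `(1, 1)`, `(0, 1)` stand for the identity,
`X`, `Y`, `Z`. Multiplication of operators is addition of pairs. -/

/-- Pauli operators on the set `Q` of qubits, modulo phases. -/
abbrev Pauli (Q : Type) : Type := Q → ZMod 2 × ZMod 2

/-- The single-qubit Pauli `X`. -/
def pX : ZMod 2 × ZMod 2 := (1, 0)

/-- The single-qubit Pauli `Z`. -/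
def pZ : ZMod 2 × ZMod 2 := (0, 1)

section Codes

variable {Q : Type} [Fintype Q] {ι : Type} [Fintype ι]

/-- The commutator of two Pauli operators: `0` if they commute, `1` if they anticommute. -/
def commutator (a b : Pauli Q) : ZMod 2 :=
  ∑ q, ((a q).1 * (b q).2 + (a q).2 * (b q).1)

/-- The number of qubits on which a Pauli operator acts nontrivially. -/
def weight (a : Pauli Q) : ℕ := (Finset.univ.filter fun q => a q ≠ 0).card

/-- The group generated by a family of Pauli operators. For a subsystem code given by its gauge
checks this is the gauge group, for a stabilizer code it is the stabilizer group. -/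
def gaugeGroup (g : ι → Pauli Q) : Submodule (ZMod 2) (Pauli Q) :=
  Submodule.span (ZMod 2) (Set.range g)

/-- The Pauli operators that commute with every element of `G`. -/
def normalizer (G : Submodule (ZMod 2) (Pauli Q)) : Submodule (ZMod 2) (Pauli Q) where
  carrier := {a | ∀ b ∈ G, commutator a b = 0}
  zero_mem' := by
    intro b _
    simp [commutator]
  add_mem' := by
    intro a a' ha ha' b hb
    have h : commutator (a + a') b = commutator a b + commutator a' b := by
      simp only [commutator, ← Finset.sum_add_distrib]
      refine Finset.sum_congr rfl fun q _ => ?_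
      simp only [Pi.add_apply, Prod.fst_add, Prod.snd_add]
      ring
    rw [h, ha b hb, ha' b hb, add_zero]
  smul_mem' := by
    intro c a ha b hb
    have h : commutator (c • a) b = c * commutator a b := by
      simp only [commutator, Finset.mul_sum]
      refine Finset.sum_congr rfl fun q _ => ?_
      simp only [Pi.smul_apply, Prod.smul_fst, Prod.smul_snd, smul_eq_mul]
      ring
    rw [h, ha b hb, mul_zero]

/-- The number `k` of logical qubits: the group `N(G) / (N(G) ∩ G)` of bare logical operators
modulo gauge operators has `4 ^ k` elements, so `k` is half its dimension over `𝔽₂`. The value is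
taken in `ℚ` so that nothing is rounded. -/
def numLogicalQubits (g : ι → Pauli Q) : ℚ :=
  (Module.finrank (ZMod 2)
    (normalizer (gaugeGroup g) ⧸ (gaugeGroup g).submoduleOf (normalizer (gaugeGroup g))) : ℚ) / 2

/-- The (dressed) logical operators `N(G) · G \ G`. -/
def logicals (g : ι → Pauli Q) : Set (Pauli Q) :=
  {a | a ∈ normalizer (gaugeGroup g) ⊔ gaugeGroup g ∧ a ∉ gaugeGroup g}

/-- The distance: the least weight of a logical operator (`⊤` if there is none, i.e. if `k = 0`).
For a stabilizer code this is the least weight in `N(S) \ S`. -/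
def distance (g : ι → Pauli Q) : ℕ∞ := ⨅ a ∈ logicals g, (weight a : ℕ∞)

/-- The degree of a qubit: the number of multi-qubit checks that act on it.
Single-qubit checks are not counted. -/
def degree (g : ι → Pauli Q) (q : Q) : ℕ :=
  (Finset.univ.filter fun i => 2 ≤ weight (g i) ∧ g i q ≠ 0).card

/-- A code is local on the graph `G`, with at most `ρ` qubits per vertex, for the placement `pos`
of its qubits: any two qubits in the support of a check are at equal or adjacent vertices. -/
def IsLocalOn {V : Type} (G : SimpleGraph V) (ρ : ℕ) (pos : Q → V) (g : ι → Pauli Q) : Prop :=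
  (∀ x, {q | pos q = x}.ncard ≤ ρ) ∧
    ∀ i p q, g i p ≠ 0 → g i q ≠ 0 → pos p = pos q ∨ G.Adj (pos p) (pos q)

end Codes

/-- The hypercubic lattice `ℤ^D`. -/
def lattice (D : ℕ) : SimpleGraph (Fin D → ℤ) where
  Adj x y := ∑ i, |x i - y i| = 1
  symm := ⟨fun x y h => by simpa only [abs_sub_comm] using h⟩
  loopless := ⟨fun x h => by simp at h⟩

/-! ### The input code -/

/-- A stabilizer code on `n` qubits, given by `r` commuting checks, none of them the identity. -/
structure StabilizerCode (n r : ℕ) where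
  check : Fin r → Pauli (Fin n)
  commute : ∀ s t, commutator (check s) (check t) = 0
  nontrivial : ∀ s, check s ≠ 0

namespace StabilizerCode

variable {n r : ℕ} (S : StabilizerCode n r)

/-- Every check has weight at most `w` and every qubit is in the support of at most `δ` checks. -/
def IsLDPC (w δ : ℕ) : Prop :=
  (∀ s, weight (S.check s) ≤ w) ∧
    ∀ q, (Finset.univ.filter fun s => S.check s q ≠ 0).card ≤ δ

/-- The qubit–check pairs `(q, s)` with `q` in the support of `s`. -/
def Pair : Type := {e : Fin n × Fin r // S.check e.2 e.1 ≠ 0}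

instance : Fintype S.Pair := inferInstanceAs (Fintype {e : Fin n × Fin r // S.check e.2 e.1 ≠ 0})

variable {S}

/-- The qubit of a pair. -/
def Pair.qubit (e : S.Pair) : Fin n := e.1.1

/-- The check of a pair. -/
def Pair.chk (e : S.Pair) : Fin r := e.1.2

/-- The single-qubit Pauli by which the check of a pair acts on its qubit. -/
def Pair.pauli (e : S.Pair) : ZMod 2 × ZMod 2 := S.check e.chk e.qubit

/-- Two pairs lie on the same Pauli branch: same qubit `q` and same Pauli type `P`. The copy
qubits of the `P`-branch of `q` are indexed by the pairs `(q, s)` of type `P`, in the order of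
the checks `s`. -/
def SameBranch (e f : S.Pair) : Prop := e.qubit = f.qubit ∧ e.pauli = f.pauli

/-- `e` is the first pair of its branch. -/
def IsBranchStart (e : S.Pair) : Prop := ∀ f : S.Pair, SameBranch e f → e.chk ≤ f.chk

/-- `f` comes directly after `e` on their common branch. -/
def BranchNext (e f : S.Pair) : Prop :=
  SameBranch e f ∧ e.chk < f.chk ∧
    ∀ g : S.Pair, SameBranch e g → ¬ (e.chk < g.chk ∧ g.chk < f.chk)

/-- `e` and `f` belong to the same check, and the qubit of `f` is the next one after that of `e`
in the support of this check. -/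
def CheckNext (e f : S.Pair) : Prop :=
  e.chk = f.chk ∧ e.qubit < f.qubit ∧
    ∀ g : S.Pair, g.chk = e.chk → ¬ (e.qubit < g.qubit ∧ g.qubit < f.qubit)

end StabilizerCode

/-! ### The `D`-dimensional wire code construction -/

/-- The side length `m = ⌈N^{1/(D-1)}⌉` of the routing box, where `N` is the number of qubits,
or the number of checks if this is larger. -/
def boxSide (n r D : ℕ) : ℕ := ⌈((max n r : ℕ) : ℝ) ^ (1 / ((D : ℝ) - 1))⌉₊

/-- The box `[m]^{D-1} × {0, …, h}` in `ℤ^D`. -/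
def box (D m h : ℕ) : Set (Fin D → ℤ) :=
  {x | (∀ i : Fin D, (i : ℕ) + 1 < D → 0 ≤ x i ∧ x i < m) ∧
    ∀ i : Fin D, (i : ℕ) + 1 = D → 0 ≤ x i ∧ x i ≤ h}

/-- The horizontal layer of `ℤ^D` at height `h`. -/
def layer (D h : ℕ) : Set (Fin D → ℤ) := {x | ∀ i : Fin D, (i : ℕ) + 1 = D → x i = h}

/-- The choices made in a run of the `D`-dimensional wire code construction on the code `S`, with
bounds `w` and `δ` for weight and degree and with the box `[m]^{D-1} × {0, …, c m}`. -/
structure Run {n r : ℕ} (S : StabilizerCode n r) (D c w δ : ℕ) where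
  /-- Every qubit gets an unoccupied lattice site in the bottom layer. -/
  qubitSite : Fin n → (Fin D → ℤ)
  qubitSite_injective : Function.Injective qubitSite
  qubitSite_mem : ∀ q, qubitSite q ∈ box D (boxSide n r D) (c * boxSide n r D) ∩ layer D 0
  /-- Every check gets a lattice site of its own in the top layer. -/
  checkSite : Fin r → (Fin D → ℤ)
  checkSite_injective : Function.Injective checkSite
  checkSite_mem : ∀ s, checkSite s ∈
    box D (boxSide n r D) (c * boxSide n r D) ∩ layer D (c * boxSide n r D)
  /-- The qubit–check pairs are partitioned into classes; two pairs in a class have neither a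
  qubit nor a check in common. -/
  color : S.Pair → Fin (w * δ + 1)
  color_valid : ∀ e f : S.Pair, color e = color f → e ≠ f → e.qubit ≠ f.qubit ∧ e.chk ≠ f.chk
  /-- The pairs are routed by lattice paths inside the box; the paths of one class are
  edge-disjoint. -/
  route : ∀ e : S.Pair, (lattice D).Walk (qubitSite e.qubit) (checkSite e.chk)
  route_isPath : ∀ e, (route e).IsPath
  route_mem : ∀ e, ∀ x ∈ (route e).support, x ∈ box D (boxSide n r D) (c * boxSide n r D)
  route_disjoint : ∀ e f, color e = color f → e ≠ f →
    (route e).edges.Disjoint (route f).edges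

namespace Run

variable {n r : ℕ} {S : StabilizerCode n r} {D c w δ : ℕ} (R : Run S D c w δ)

/-- The number of vertices of the route of a pair, i.e. of wire qubits placed along it. -/
def numVerts (e : S.Pair) : ℕ := (R.route e).length + 1

/-- The link qubits: one for each two consecutive elements of the support of a check. -/
def Link (S : StabilizerCode n r) : Type :=
  {l : S.Pair × S.Pair // StabilizerCode.CheckNext l.1 l.2}

open Classical in
instance : Fintype (Link S) :=
  inferInstanceAs (Fintype {l : S.Pair × S.Pair // StabilizerCode.CheckNext l.1 l.2})

/-- The qubits of the wire code: the data qubits of the input code, a copy qubit for every pair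
`(q, s)`, a wire qubit for every vertex `a₀, a₁, …, a_T` of the route of a pair, and the link
qubits of the checks. -/
inductive Qubit : Type
  | data (q : Fin n)
  | copy (e : S.Pair)
  | wire (e : S.Pair) (t : Fin (R.numVerts e))
  | link (l : Link S)

/-- The qubits form a finite disjoint union. -/
def qubitEquiv :
    (Fin n ⊕ S.Pair) ⊕ ((Σ e : S.Pair, Fin (R.numVerts e)) ⊕ Link S) ≃ R.Qubit where
  toFun
    | .inl (.inl q) => .data q
    | .inl (.inr e) => .copy e
    | .inr (.inl ⟨e, t⟩) => .wire e t
    | .inr (.inr l) => .link l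
  invFun
    | .data q => .inl (.inl q)
    | .copy e => .inl (.inr e)
    | .wire e t => .inr (.inl ⟨e, t⟩)
    | .link l => .inr (.inr l)
  left_inv := by rintro ((q | e) | (⟨e, t⟩ | l)) <;> rfl
  right_inv := by rintro (q | e | ⟨e, t⟩ | l) <;> rfl

instance : Fintype R.Qubit := Fintype.ofEquiv _ R.qubitEquiv

/-- The placement of the qubits. The branches of a data qubit are placed at the site of this
qubit, wire qubits at the vertices of the route, link qubits at the site of the check. Several
qubits may be stacked at a site. -/
def pos : R.Qubit → (Fin D → ℤ)
  | .data q => R.qubitSite q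
  | .copy e => R.qubitSite e.qubit
  | .wire e t => (R.route e).getVert t
  | .link l => R.checkSite l.1.1.chk

open Classical in
/-- The two-qubit checks of the Pauli branches. On the `P`-branch of `q` with copy qubits
`r₁, …, r_ℓ` these are `P_q Z_{r₁}` and `Z_{r_i} Z_{r_{i+1}}`, each listed at the copy qubit
with the larger index. -/
def copyCheck (f : S.Pair) : Pauli R.Qubit
  | .data q => if q = f.qubit ∧ StabilizerCode.IsBranchStart f then f.pauli else 0
  | .copy e => if e = f ∨ StabilizerCode.BranchNext e f then pZ else 0
  | .wire _ _ => 0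
  | .link _ => 0

open Classical in
/-- The two-qubit checks along the route `a₀, …, a_T` of a pair `f`: the check
`Z_{copy f} Z_{a₀}` for `t = 0`, and `Z_{a_{t-1}} Z_{a_t}` for `t ≥ 1`. -/
def wireCheck (f : S.Pair) (t : Fin (R.numVerts f)) : Pauli R.Qubit
  | .data _ => 0
  | .copy e => if e = f ∧ (t : ℕ) = 0 then pZ else 0
  | .wire e u => if e = f ∧ ((u : ℕ) = t ∨ (u : ℕ) + 1 = t) then pZ else 0
  | .link _ => 0

open Classical in
/-- The checks of the `Z`-branch that runs through the ends `a_{T_1}, …, a_{T_p}` of the `p`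
routes of a check, with link qubits `b₁, …, b_{p-1}` between them:
`Z_{a_{T_i}} Z_{b_{i-1}} Z_{b_i}`, where `b₀` and `b_p` are omitted. -/
def junctionCheck (f : S.Pair) : Pauli R.Qubit
  | .data _ => 0
  | .copy _ => 0
  | .wire e u => if e = f ∧ (u : ℕ) + 1 = R.numVerts f then pZ else 0
  | .link l => if l.1.1 = f ∨ l.1.2 = f then pZ else 0

open Classical in
/-- The Pauli operator `X` on the single qubit `v`. -/
def singleX (v : R.Qubit) : Pauli R.Qubit := fun u => if u = v then pX else 0

/-- Index set of the gauge checks: branch checks, route checks, junction checks, and the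
single-qubit `X` checks on all copy, wire and link qubits. -/
abbrev CheckIndex : Type :=
  (S.Pair ⊕ (Σ e : S.Pair, Fin (R.numVerts e)) ⊕ S.Pair) ⊕
    (S.Pair ⊕ (Σ e : S.Pair, Fin (R.numVerts e)) ⊕ Link S)

/-- The gauge checks of the wire code. -/
def gaugeCheck : R.CheckIndex → Pauli R.Qubit
  | .inl (.inl f) => R.copyCheck f
  | .inl (.inr (.inl ⟨f, t⟩)) => R.wireCheck f t
  | .inl (.inr (.inr f)) => R.junctionCheck f
  | .inr (.inl e) => R.singleX (.copy e)
  | .inr (.inr (.inl ⟨e, t⟩)) => R.singleX (.wire e t)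
  | .inr (.inr (.inr l)) => R.singleX (.link l)

end Run

end WireCode

end

/-! The proof has two halves: a routing argument for the existence of a run and for the counts, and
an algebraic argument for the code parameters.

Routing. Write `D = d + 1` with `d ≥ 2`. The pairs of one class match distinct bottom sites with
distinct top sites, and such a matching extends to a permutation of `[m]^d`. By König's edge
colouring theorem a permutation of the grid is one along an axis, then one along the other axes,
then one along the first axis again. Iterating over the axes leaves only permutations along single
axes (`mem_pow_of_permsAlong_subset`). Such a permutation is sorted by `m` rounds, each transposing
two points on every line of that direction. A round fits into three horizontal layers, because one
of the two points can travel along a neighbouring line. Hence every permutation is a product of `6 d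
m` permutations routable in one layer (`mem_layerRoutable_pow`), and stacking the layers gives the
constant `6 d`. Conversely, in any run, edge-disjointness bounds the routes of one class through a
site, so the density is bounded, and density times box volume bounds the number of qubits.

Code parameters. On auxiliary qubits `X` is a gauge operator, and the other checks move `Z` to the
data qubits: `Z` on a copy or wire qubit of `(q, s)` becomes `P_q`, and `Z` on a link becomes the
part of `s` on an initial segment of its support. Under this linear map `push` all branch and route
checks vanish and the junction checks telescope: only the last one of each check survives, and it
becomes `s` itself. So `push` respects the two gauge groups, `a` and `embed (push a)` differ by a
gauge operator, and `bare`, the adjoint of `push` for the commutator form, lifts bare logical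
operators. This gives equality of `k`. The distance bound follows because a single wire code qubit
contributes to at most `w + 1` data qubits under `push`. -/

namespace WireCode

/-! ### König's theorem and the decomposition of grid permutations -/

open Finset in
/-- König's edge colouring theorem for regular bipartite multigraphs: the edges `s`, with ends
given by `f` and `g`, can be properly coloured by `k` colours. -/
theorem exists_proper_edgeColoring {E B : Type*} [DecidableEq E] [Fintype B] [DecidableEq B]
    (f g : E → B) (k : ℕ) (s : Finset E) (hf : ∀ b, #{e ∈ s | f e = b} = k)
    (hg : ∀ b, #{e ∈ s | g e = b} = k) :
    ∃ c : E → ℕ, (∀ e ∈ s, c e < k) ∧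
      (∀ e ∈ s, ∀ e' ∈ s, f e = f e' → c e = c e' → e = e') ∧
      (∀ e ∈ s, ∀ e' ∈ s, g e = g e' → c e = c e' → e = e') := by
  induction k generalizing s with
  | zero =>
    have hs : ∀ e, e ∉ s := by
      intro e he
      have := hf (f e)
      rw [card_eq_zero, filter_eq_empty_iff] at this
      exact this he rfl
    exact ⟨fun _ => 0, fun e he => (hs e he).elim, fun e he => (hs e he).elim,
      fun e he => (hs e he).elim⟩
  | succ k ih =>
    -- Hall's theorem. The condition holds by double counting: the `(k + 1) |u|` edges leaving `u`
    -- are among the `(k + 1) |N|` edges that end in its neighbourhood `N`.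
    obtain ⟨h, hinj, hmem⟩ := (Finset.all_card_le_biUnion_card_iff_exists_injective
      (fun b => ({e ∈ s | f e = b} : Finset E).image g)).1 (by
        intro u
        set N := u.biUnion fun b => ({e ∈ s | f e = b} : Finset E).image g
        have h1 : #{e ∈ s | f e ∈ u} = (k + 1) * #u := by
          rw [card_eq_sum_card_fiberwise (f := f) (t := u) (fun e he => by
            simp only [coe_filter, Set.mem_ofPred_eq] at he; exact he.2), mul_comm,
            ← smul_eq_mul, ← sum_const]
          refine sum_congr rfl fun b hb => ?_
          rw [← hf b, filter_filter]
          congr 1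
          ext e
          simp only [mem_filter]
          constructor
          · rintro ⟨h1, h2, h3⟩; exact ⟨h1, h3⟩
          · rintro ⟨h1, h3⟩; exact ⟨h1, h3 ▸ hb, h3⟩
        have h2 : #{e ∈ s | g e ∈ N} = (k + 1) * #N := by
          rw [card_eq_sum_card_fiberwise (f := g) (t := N) (fun e he => by
            simp only [coe_filter, Set.mem_ofPred_eq] at he; exact he.2), mul_comm,
            ← smul_eq_mul, ← sum_const]
          refine sum_congr rfl fun b hb => ?_
          rw [← hg b, filter_filter]
          congr 1
          ext e
          simp only [mem_filter]
          constructor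
          · rintro ⟨h1, h2, h3⟩; exact ⟨h1, h3⟩
          · rintro ⟨h1, h3⟩; exact ⟨h1, h3 ▸ hb, h3⟩
        have h3 : #{e ∈ s | f e ∈ u} ≤ #{e ∈ s | g e ∈ N} := by
          refine card_le_card fun e he => ?_
          rw [mem_filter] at he ⊢
          refine ⟨he.1, mem_biUnion.2 ⟨f e, he.2, mem_image.2 ⟨e, ?_, rfl⟩⟩⟩
          exact mem_filter.2 ⟨he.1, rfl⟩
        rw [h1, h2] at h3
        exact Nat.le_of_mul_le_mul_left h3 k.succ_pos)
    have : ∀ b, ∃ e ∈ s, f e = b ∧ g e = h b := by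
      intro b
      obtain ⟨e, he, heq⟩ := mem_image.1 (hmem b)
      rw [mem_filter] at he
      exact ⟨e, he.1, he.2, heq⟩
    choose t hts htf htg using this
    -- The matching is therefore perfect on both sides, so deleting it lowers every degree by
    -- exactly one; its edges get the new colour `k`.
    have hsurj : Function.Surjective h := Finite.surjective_of_injective hinj
    have hM : ∀ e, t (f e) = e ↔ e ∈ univ.image t := by
      intro e
      rw [mem_image]
      constructor
      · intro he; exact ⟨f e, mem_univ _, he⟩
      · rintro ⟨b, -, rfl⟩; rw [htf]
    have hcard : ∀ (φ : E → B) (b : B) (b₀ : B), φ (t b₀) = b →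
        (∀ b', φ (t b') = b → b' = b₀) → #{e ∈ s | φ e = b} = k + 1 →
        #{e ∈ s.filter (fun e => t (f e) ≠ e) | φ e = b} = k := by
      intro φ b b₀ h1 h2 h3
      have : ({e ∈ s.filter (fun e => t (f e) ≠ e) | φ e = b} : Finset E)
          = ({e ∈ s | φ e = b} : Finset E).erase (t b₀) := by
        ext e
        simp only [mem_filter, mem_erase]
        constructor
        · rintro ⟨⟨h4, h5⟩, h6⟩
          refine ⟨?_, h4, h6⟩
          rintro rfl
          exact h5 (by rw [htf])
        · rintro ⟨h4, h5, h6⟩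
          refine ⟨⟨h5, fun h7 => h4 ?_⟩, h6⟩
          rw [← h7] at h6
          rw [← h2 _ h6, h7]
      rw [this, card_erase_of_mem (mem_filter.2 ⟨hts _, h1⟩), h3, Nat.add_sub_cancel]
    obtain ⟨c, hc1, hc2, hc3⟩ := ih (s.filter (fun e => t (f e) ≠ e))
      (fun b => hcard f b b (htf b) (fun b' hb' => by rw [← hb', htf]) (hf b))
      (fun b => by
        obtain ⟨b₀, rfl⟩ := hsurj b
        exact hcard g _ b₀ (htg b₀) (fun b' hb' => hinj (by rw [← hb', htg])) (hg _))
    refine ⟨fun e => if t (f e) = e then k else c e, ?_, ?_, ?_⟩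
    · intro e he
      dsimp only
      split_ifs with h1
      · exact k.lt_succ_self
      · exact (hc1 e (mem_filter.2 ⟨he, h1⟩)).trans k.lt_succ_self
    · intro e he e' he' hfe hce
      dsimp only at hce
      split_ifs at hce with h1 h2 h2
      · rw [← h1, ← h2, hfe]
      · exact absurd hce.symm (hc1 e' (mem_filter.2 ⟨he', h2⟩)).ne
      · exact absurd hce (hc1 e (mem_filter.2 ⟨he, h1⟩)).ne
      · exact hc2 e (mem_filter.2 ⟨he, h1⟩) e' (mem_filter.2 ⟨he', h2⟩) hfe hce
    · intro e he e' he' hge hce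
      dsimp only at hce
      split_ifs at hce with h1 h2 h2
      · rw [← h1, ← h2, htg, htg] at hge
        rw [← h1, ← h2, hinj hge]
      · exact absurd hce.symm (hc1 e' (mem_filter.2 ⟨he', h2⟩)).ne
      · exact absurd hce (hc1 e (mem_filter.2 ⟨he, h1⟩)).ne
      · exact hc3 e (mem_filter.2 ⟨he, h1⟩) e' (mem_filter.2 ⟨he', h2⟩) hge hce

section Permutations

open scoped Pointwise

variable {ι : Type*} [Fintype ι] [DecidableEq ι] {m : ℕ}

/-- The permutations of the grid `ι → Fin m` that change only the coordinates in `s`. -/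
def permsAlong (m : ℕ) (s : Finset ι) : Set (Equiv.Perm (ι → Fin m)) :=
  {σ | ∀ x, ∀ j ∉ s, σ x j = x j}

/-- A permutation of a grid is the product of a permutation along an axis, of one along the
remaining axes and of another one along the first axis. -/
theorem permsAlong_insert_subset (i : ι) (s : Finset ι) :
    permsAlong m (insert i s) ⊆ permsAlong m {i} * permsAlong m s * permsAlong m {i} := by
  intro π hπ
  let F : (ι → Fin m) → ({k // k ≠ i} → Fin m) := fun x k => x k
  have hF : ∀ x y, F x = F y → x i = y i → x = y := by
    intro x y h1 h2
    ext k
    by_cases hk : k = i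
    · rw [hk, h2]
    · exact congrArg Fin.val (congrFun h1 ⟨k, hk⟩)
  have hcard : ∀ b, (Finset.univ.filter fun x => F x = b).card = m := by
    intro b
    conv_rhs => rw [← Fintype.card_fin m]
    rw [← Finset.card_univ]
    symm
    refine Finset.card_bij (fun a _ => fun k => if h : k = i then a else b ⟨k, h⟩) ?_ ?_ ?_
    · intro a _
      simp only [Finset.mem_filter, Finset.mem_univ, true_and]
      funext k
      simp [F, k.2]
    · intro a _ a' _ h
      simpa using congrFun h i
    · intro x hx
      simp only [Finset.mem_filter, Finset.mem_univ, true_and] at hx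
      refine ⟨x i, Finset.mem_univ _, hF _ _ ?_ (by simp)⟩
      rw [← hx]
      funext k
      simp [F, k.2]
  -- The bipartite multigraph has the lines parallel to axis `i` as vertices on both sides; the
  -- point `x` is an edge from the line of `x` to the line of `π x`. The colour of `x` is the
  -- `i`-coordinate at which it changes lines.
  obtain ⟨c, hc, hc1, hc2⟩ := exists_proper_edgeColoring F (fun x => F (π x)) m Finset.univ hcard
    (by
      intro b
      exact (Finset.card_bij (fun x _ => π x) (by simp) (by simp)
        (fun y hy => ⟨π.symm y, by simpa using hy, by simp⟩)).trans (hcard b))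
  let C : (ι → Fin m) → Fin m := fun x => ⟨c x, hc x (Finset.mem_univ _)⟩
  have hFu : ∀ x a, F (Function.update x i a) = F x := by
    intro x a
    funext k
    simp [F, Function.update_of_ne k.2]
  have inj1 : Function.Injective fun x => Function.update x i (C x) := by
    intro x y h
    have h1 := congrArg F h
    have h2 := congrFun h i
    simp only [hFu, Function.update_self] at h1 h2
    exact hc1 x (Finset.mem_univ _) y (Finset.mem_univ _) h1 (congrArg Fin.val h2)
  have inj2 : Function.Injective fun x => Function.update (π x) i (C x) := by
    intro x y h
    have h1 := congrArg F h
    have h2 := congrFun h i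
    simp only [hFu, Function.update_self] at h1 h2
    exact hc2 x (Finset.mem_univ _) y (Finset.mem_univ _) h1 (congrArg Fin.val h2)
  let σ := Equiv.ofBijective _ (Finite.injective_iff_bijective.1 inj1)
  let ρ := Equiv.ofBijective _ (Finite.injective_iff_bijective.1 inj2)
  have hσ : ∀ x, σ x = Function.update x i (C x) := fun x => rfl
  have hρ : ∀ x, ρ x = Function.update (π x) i (C x) := fun x => rfl
  -- `σ` moves each point on its line to the level given by its colour, `ρ * σ⁻¹` moves it within
  -- that level to its target line, and `π * ρ⁻¹` moves it along the target line. Properness at the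
  -- two ends makes `σ` and `ρ` injective.
  refine Set.mem_mul.2 ⟨(π * ρ⁻¹) * (ρ * σ⁻¹), Set.mul_mem_mul ?_ ?_, σ, ?_, by group⟩
  · intro z j hj
    obtain ⟨x, rfl⟩ := ρ.surjective z
    change π (ρ.symm (ρ x)) j = ρ x j
    rw [Equiv.symm_apply_apply, hρ, Function.update_of_ne (by simpa using hj)]
  · intro z j hj
    obtain ⟨x, rfl⟩ := σ.surjective z
    change ρ (σ.symm (σ x)) j = σ x j
    rw [Equiv.symm_apply_apply, hρ, hσ]
    by_cases hji : j = i
    · rw [hji, Function.update_self, Function.update_self]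
    · rw [Function.update_of_ne hji, Function.update_of_ne hji, hπ x j (by simp [hji, hj])]
  · intro x j hj
    rw [hσ, Function.update_of_ne (by simpa using hj)]

/-- If the permutations along each axis are products of `k` elements of `L`, then every
permutation of the grid is a product of `2 k |ι|` of them. -/
theorem mem_pow_of_permsAlong_subset {L : Set (Equiv.Perm (ι → Fin m))} {k : ℕ}
    (h : ∀ i, permsAlong m {i} ⊆ L ^ k) (π : Equiv.Perm (ι → Fin m)) :
    π ∈ L ^ (2 * k * Fintype.card ι) := by
  have key : ∀ s : Finset ι, permsAlong m s ⊆ L ^ (2 * k * s.card) := by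
    intro s
    induction s using Finset.induction_on with
    | empty =>
      intro σ hσ
      have : σ = 1 := by
        ext x j
        rw [hσ x j (by simp)]
        rfl
      simp [this]
    | insert i s hi ih =>
      refine (permsAlong_insert_subset i s).trans ?_
      have : 2 * k * (insert i s).card = k + 2 * k * s.card + k := by
        rw [Finset.card_insert_of_notMem hi]; ring
      rw [this, pow_add, pow_add]
      exact Set.mul_subset_mul (Set.mul_subset_mul (h i) ih) (h i)
  exact key Finset.univ fun x j hj => absurd (Finset.mem_univ j) hj

end Permutations

end WireCode

/-! ### Routing permutations within horizontal layers -/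

namespace WireCode

section Layers

open scoped Pointwise

variable {d m : ℕ}

/-- The cubic grid `[m]^d`. -/
def gridGraph (d m : ℕ) : SimpleGraph (Fin d → Fin m) :=
  (lattice d).comap fun x k => ((x k : ℕ) : ℤ)

/-- A permutation of the grid is layer routable if its grid points can be joined to their images
by edge-disjoint walks in the grid. -/
def layerRoutable (d m : ℕ) : Set (Equiv.Perm (Fin d → Fin m)) :=
  {σ | ∃ p : ∀ x, (gridGraph d m).Walk x (σ x), ∀ x y, x ≠ y → (p x).edges.Disjoint (p y).edges}

theorem gridGraph_adj_update (x : Fin d → Fin m) (i : Fin d) {a b : Fin m}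
    (h : (SimpleGraph.pathGraph m).Adj a b) :
    (gridGraph d m).Adj (Function.update x i a) (Function.update x i b) := by
  rw [SimpleGraph.pathGraph_adj] at h
  change ∑ k, |(((Function.update x i a k : Fin m) : ℕ) : ℤ) -
    ((Function.update x i b k : Fin m) : ℕ)| = 1
  rw [Finset.sum_eq_single i]
  · simp only [Function.update_self]
    rcases h with h | h <;> rw [← h] <;> push_cast <;> simp
  · intro k _ hk
    simp [Function.update_of_ne hk]
  · simp

/-- Two points of the grid that differ in one coordinate are joined by a straight walk. -/
theorem exists_straight_walk (x : Fin d → Fin m) (i : Fin d) (a b : Fin m) :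
    ∃ p : (gridGraph d m).Walk (Function.update x i a) (Function.update x i b),
      ∀ v ∈ p.support, ∀ k ≠ i, v k = x k := by
  let φ : SimpleGraph.pathGraph m →g gridGraph d m :=
    ⟨fun a => Function.update x i a, fun h => gridGraph_adj_update x i h⟩
  obtain ⟨p⟩ := SimpleGraph.pathGraph_preconnected m a b
  refine ⟨p.map φ, fun v hv k hk => ?_⟩
  rw [SimpleGraph.Walk.support_map, List.mem_map] at hv
  obtain ⟨c, -, rfl⟩ := hv
  exact Function.update_of_ne hk _ _

/-- The involution of the grid that transposes two points on each line parallel to the axis `i`. -/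
def lineSwap (i : Fin d) (α β : (Fin d → Fin m) → Fin m)
    (hα : ∀ x a, α (Function.update x i a) = α x) (hβ : ∀ x a, β (Function.update x i a) = β x) :
    Equiv.Perm (Fin d → Fin m) :=
  Function.Involutive.toPerm (fun x => Function.update x i (Equiv.swap (α x) (β x) (x i)))
    (fun x => by simp [hα, hβ])

theorem lineSwap_apply (i : Fin d) (α β : (Fin d → Fin m) → Fin m) (hα hβ) (x) :
    lineSwap i α β hα hβ x = Function.update x i (Equiv.swap (α x) (β x) (x i)) := rfl

theorem exists_adjacent (hm : 2 ≤ m) (y : Fin m) :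
    ∃ z, (SimpleGraph.pathGraph m).Adj y z := by
  by_cases h : (y : ℕ) + 1 < m
  · exact ⟨⟨y + 1, h⟩, SimpleGraph.pathGraph_adj.2 (Or.inl rfl)⟩
  · exact ⟨⟨y - 1, by omega⟩, SimpleGraph.pathGraph_adj.2 (Or.inr (by simp; omega))⟩

/-- On sufficiently separated lines, arbitrary transpositions are layer routable at once: one of
the two points moves along the line itself and the other one along a neighbouring line. -/
theorem lineSwap_mem_layerRoutable {i j : Fin d} (hij : j ≠ i) (r : ℕ)
    (α β : (Fin d → Fin m) → Fin m) (hα hβ)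
    (hr : ∀ x, α x ≠ β x → (x j : ℕ) % 3 = r) :
    lineSwap i α β hα hβ ∈ layerRoutable d m := by
  classical
  -- Each edge must reveal its walk: it stays within distance one of the line of `x` in direction
  -- `j`, and it lies on that line exactly when `x` is the point at `α`. Points that are not moved
  -- get the empty walk.
  have key : ∀ x, ∃ p : (gridGraph d m).Walk x (lineSwap i α β hα hβ x),
      ∀ e ∈ p.edges, α x ≠ β x ∧ (x i = α x ∨ x i = β x) ∧
        (∀ v ∈ e, (∀ k, k ≠ i → k ≠ j → v k = x k) ∧
          (v j : ℕ) ≤ x j + 1 ∧ (x j : ℕ) ≤ v j + 1) ∧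
        (x i = α x ↔ ∀ v ∈ e, v j = x j) := by
    intro x
    by_cases hx : lineSwap i α β hα hβ x = x
    · rw [hx]
      exact ⟨SimpleGraph.Walk.nil, by simp⟩
    have hne : α x ≠ β x := by
      intro h
      apply hx
      simp [lineSwap_apply, h]
    have hcase : x i = α x ∨ x i = β x := by
      by_contra! h
      apply hx
      simp [lineSwap_apply, Equiv.swap_apply_of_ne_of_ne h.1 h.2]
    have hm : 2 ≤ m := by
      have h1 := (α x).2
      have h2 := (β x).2
      have h3 : (α x : ℕ) ≠ β x := fun h => hne (Fin.ext h)
      omega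
    rcases hcase with h | h
    · obtain ⟨p, hp⟩ := exists_straight_walk x i (α x) (β x)
      have e1 : Function.update x i (α x) = x := by rw [← h, Function.update_eq_self]
      have e2 : Function.update x i (β x) = lineSwap i α β hα hβ x := by
        rw [lineSwap_apply, h, Equiv.swap_apply_left]
      refine ⟨p.copy e1 e2, fun e he => ?_⟩
      rw [SimpleGraph.Walk.edges_copy] at he
      have hv : ∀ v ∈ e, ∀ k ≠ i, v k = x k := fun v hv =>
        hp v (SimpleGraph.Walk.mem_support_of_mem_edges he hv)
      refine ⟨hne, Or.inl h, fun v hve => ⟨fun k hk _ => hv v hve k hk, ?_⟩, ?_⟩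
      · rw [hv v hve j hij]
        omega
      · simp only [h, true_iff]
        exact fun v hve => hv v hve j hij
    -- The point at `β` sidesteps to the adjacent line with `j`-coordinate `z`, travels there and
    -- steps back; every edge of this detour has an end off the original line.
    · obtain ⟨z, hz⟩ := exists_adjacent hm (x j)
      have hzj := SimpleGraph.pathGraph_adj.1 hz
      have hzne : z ≠ x j := hz.ne'
      obtain ⟨p, hp⟩ := exists_straight_walk (Function.update x j z) i (β x) (α x)
      have e1 : Function.update (Function.update x j z) i (β x) = Function.update x j z := by
        rw [Function.update_comm hij, ← h, Function.update_eq_self]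
      have a1 : (gridGraph d m).Adj x (Function.update x j z) := by
        have := gridGraph_adj_update x j hz
        rwa [Function.update_eq_self] at this
      have a2 : (gridGraph d m).Adj (Function.update (Function.update x j z) i (α x))
          (lineSwap i α β hα hβ x) := by
        have := gridGraph_adj_update (Function.update x i (α x)) j hz.symm
        rw [Function.update_comm hij.symm] at this
        convert this using 1
        rw [lineSwap_apply, h, Equiv.swap_apply_right]
        ext k
        by_cases hk : k = j
        · subst hk
          simp [Function.update_of_ne hij]
        · simp [Function.update_of_ne hk]
      refine ⟨SimpleGraph.Walk.cons a1 (((p.copy e1 rfl)).concat a2), fun e he => ?_⟩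
      rw [SimpleGraph.Walk.edges_cons, SimpleGraph.Walk.edges_concat, SimpleGraph.Walk.edges_copy,
        List.mem_cons, List.concat_eq_append, List.mem_append, List.mem_singleton] at he
      have hxi : ¬ x i = α x := fun h' => hne (h'.symm.trans h)
      refine ⟨hne, Or.inr h, ?_, ?_⟩
      · have b1 : ∀ v : Fin d → Fin m, (∀ k, k ≠ i → k ≠ j → v k = x k) → (v j = x j ∨ v j = z) →
            ((∀ k, k ≠ i → k ≠ j → v k = x k) ∧ (v j : ℕ) ≤ x j + 1 ∧ (x j : ℕ) ≤ v j + 1) := by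
          intro v h1 h2
          refine ⟨h1, ?_⟩
          rcases h2 with h2 | h2 <;> rw [h2] <;> omega
        rcases he with rfl | he | rfl
        · intro v hv
          rw [Sym2.mem_iff] at hv
          rcases hv with rfl | rfl
          · exact b1 _ (fun _ _ _ => rfl) (Or.inl rfl)
          · exact b1 _ (fun k _ hk => Function.update_of_ne hk _ _)
              (Or.inr (Function.update_self _ _ _))
        · intro v hv
          have := hp v (SimpleGraph.Walk.mem_support_of_mem_edges he hv)
          refine b1 _ (fun k hk hk' => ?_) (Or.inr ?_)
          · rw [this k hk, Function.update_of_ne hk']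
          · rw [this j hij, Function.update_self]
        · intro v hv
          rw [Sym2.mem_iff] at hv
          rcases hv with rfl | rfl
          · exact b1 _ (fun k hk hk' => by simp [hk, hk']) (Or.inr (by simp [hij]))
          · exact b1 _ (fun k hk hk' => by simp [lineSwap_apply, hk])
              (Or.inl (by simp [lineSwap_apply, hij]))
      · simp only [hxi, false_iff, not_forall]
        rcases he with rfl | he | rfl
        · exact ⟨_, Sym2.mem_mk_right _ _, by simpa using hzne⟩
        · induction e using Sym2.ind with
          | _ u v =>
            refine ⟨u, Sym2.mem_mk_left _ _, ?_⟩
            rw [hp u (SimpleGraph.Walk.mem_support_of_mem_edges he (Sym2.mem_mk_left _ _)) j hij]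
            simpa using hzne
        · exact ⟨_, Sym2.mem_mk_left _ _, by simpa [hij] using hzne⟩
  choose p hp using key
  refine ⟨p, fun x y hxy e hex hey => hxy ?_⟩
  obtain ⟨x1, x2, x3, x4⟩ := hp x e hex
  obtain ⟨y1, y2, y3, y4⟩ := hp y e hey
  induction e using Sym2.ind with
  | _ u v =>
    have hu := x3 u (Sym2.mem_mk_left _ _)
    have hu' := y3 u (Sym2.mem_mk_left _ _)
    -- A common edge forces the two `j`-coordinates to differ by at most two, and they agree modulo
    -- three.
    have hj : x j = y j := by
      have := hr x x1
      have := hr y y1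
      ext
      omega
    have hxy : y = Function.update x i (y i) := by
      ext k
      by_cases hk : k = i
      · rw [hk, Function.update_self]
      · rw [Function.update_of_ne hk]
        by_cases hk' : k = j
        · rw [hk', hj]
        · rw [← hu.1 k hk hk', ← hu'.1 k hk hk']
    have hα' : α y = α x := by rw [hxy, hα]
    have hβ' : β y = β x := by rw [hxy, hβ]
    rw [hα'] at y1 y2 y4
    rw [hβ'] at y1 y2
    rw [← hj, ← x4] at y4
    have hi : x i = y i := by
      by_cases h : x i = α x
      · rw [h, y4.2 h]
      · rw [x2.resolve_left h, y2.resolve_left fun h' => h (y4.1 h')]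
    rw [hxy, ← hi, Function.update_eq_self]

/-- Splitting the lines by their `j`-coordinate modulo three gives three families that are separated
enough for a single layer each. Setting `β` equal to `α` switches off the lines outside the chosen
residue class. -/
theorem lineSwap_mem_layerRoutable_pow {i j : Fin d} (hij : j ≠ i)
    (α β : (Fin d → Fin m) → Fin m) (hα hβ) :
    lineSwap i α β hα hβ ∈ layerRoutable d m ^ 3 := by
  let β' : ℕ → (Fin d → Fin m) → Fin m := fun r x => if (x j : ℕ) % 3 = r then β x else α x
  have hβ' : ∀ r x a, β' r (Function.update x i a) = β' r x := by
    intro r x a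
    simp [β', hα, hβ, hij]
  have hmem : ∀ r, lineSwap i α (β' r) hα (hβ' r) ∈ layerRoutable d m := by
    refine fun r => lineSwap_mem_layerRoutable hij r _ _ _ _ fun x hx => ?_
    by_contra h
    exact hx (by simp [β', h])
  have : lineSwap i α β hα hβ = lineSwap i α (β' 0) hα (hβ' 0) *
      lineSwap i α (β' 1) hα (hβ' 1) * lineSwap i α (β' 2) hα (hβ' 2) := by
    ext1 x
    simp only [Equiv.Perm.mul_apply, lineSwap_apply, hα, hβ', Function.update_idem,
      Function.update_self]
    have := Nat.mod_lt (x j : ℕ) (by norm_num : 0 < 3)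
    interval_cases h : (x j : ℕ) % 3 <;> simp [β', h]
  rw [this, pow_succ, pow_two]
  exact Set.mul_mem_mul (Set.mul_mem_mul (hmem 0) (hmem 1)) (hmem 2)

/-- Selection sort on all lines at once: `m` rounds, each placing one more position correctly on
every line by a transposition, and each costing three layers. -/
theorem permsAlong_singleton_subset {i j : Fin d} (hij : j ≠ i) :
    permsAlong m {i} ⊆ layerRoutable d m ^ (3 * m) := by
  have key : ∀ r ≤ m, ∀ σ ∈ permsAlong m {i}, (∀ x, (x i : ℕ) + r < m → σ x = x) →
      σ ∈ layerRoutable d m ^ (3 * r) := by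
    intro r
    induction r with
    | zero =>
      intro _ σ _ h
      have : σ = 1 := Equiv.ext fun x => h x (x i).2
      simp [this]
    | succ r ih =>
      intro hr σ hσ h
      -- The lowest position that `σ` may still move. Swapping `t` with its image makes `τ * σ` fix
      -- it, without disturbing the lower positions.
      let t : Fin m := ⟨m - (r + 1), by omega⟩
      have hσi : ∀ x, σ x = Function.update x i (σ x i) := by
        intro x
        ext k
        by_cases hk : k = i
        · rw [hk, Function.update_self]
        · rw [Function.update_of_ne hk, hσ x k (by simpa using hk)]
      let τ := lineSwap i (fun _ => t) (fun x => σ (Function.update x i t) i) (fun _ _ => rfl)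
        (fun x a => by simp)
      have hτ : ∀ x, τ x = Function.update x i
        (Equiv.swap t (σ (Function.update x i t) i) (x i)) := fun x => rfl
      have hττ : τ * τ = 1 := by
        ext1 x
        rw [Equiv.Perm.mul_apply, hτ, hτ]
        simp
      have hs : τ * σ ∈ layerRoutable d m ^ (3 * r) := by
        apply ih (by omega)
        · intro x k hk
          rw [Equiv.Perm.mul_apply, hτ, Function.update_of_ne (by simpa using hk), hσ x k hk]
        · intro x hx
          have hu : Function.update (σ x) i t = Function.update x i t := by
            rw [hσi x, Function.update_idem]
          rw [Equiv.Perm.mul_apply, hτ, hu]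
          by_cases hxt : x i = t
          · have : Function.update x i t = x := by rw [← hxt, Function.update_eq_self]
            rw [this, Equiv.swap_apply_right, hσi x, Function.update_idem, ← hxt,
              Function.update_eq_self]
          · have hlt : (x i : ℕ) + (r + 1) < m := by
              have : (x i : ℕ) ≠ m - (r + 1) := fun h' => hxt (Fin.ext h')
              omega
            rw [h x hlt, Equiv.swap_apply_of_ne_of_ne hxt, Function.update_eq_self]
            intro hc
            have h1 : σ (Function.update x i t) = σ x := by
              rw [hσi (Function.update x i t), ← hc, Function.update_idem,
                Function.update_eq_self, h x hlt]
            have h2 := congrFun (σ.injective h1) i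
            rw [Function.update_self] at h2
            exact hxt h2.symm
      have : σ = τ * (τ * σ) := by rw [← mul_assoc, hττ, one_mul]
      rw [this, show 3 * (r + 1) = 3 + 3 * r by ring, pow_add]
      exact Set.mul_mem_mul (lineSwap_mem_layerRoutable_pow hij _ _ _ _) hs
  intro σ hσ
  refine key m le_rfl σ hσ fun x hx => ?_
  omega

/-- In dimension at least two every permutation of `[m]^d` is a product of `6 d m` layer routable
ones. -/
theorem mem_layerRoutable_pow (hd : 2 ≤ d) (π : Equiv.Perm (Fin d → Fin m)) :
    π ∈ layerRoutable d m ^ (6 * d * m) := by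
  have := mem_pow_of_permsAlong_subset (L := layerRoutable d m) (k := 3 * m) (fun i => by
    -- The detours need a second horizontal direction; this is where `D ≥ 3` enters.
    have : Nontrivial (Fin d) := Fin.nontrivial_iff_two_le.2 hd
    obtain ⟨j, hj⟩ := exists_ne i
    exact permsAlong_singleton_subset hj) π
  rw [Fintype.card_fin] at this
  convert this using 2
  ring

end Layers

end WireCode

/-! ### Stacking layers into edge-disjoint paths of the box -/

namespace WireCode

section Stacking

open scoped Pointwise

variable {d m : ℕ}

/-- The lattice point above the grid point `x` at height `h`. -/
def stackPoint (x : Fin d → Fin m) (h : ℕ) : Fin (d + 1) → ℤ :=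
  Fin.snoc (α := fun _ => ℤ) (fun k => ((x k : ℕ) : ℤ)) (h : ℤ)

@[simp]
theorem stackPoint_last (x : Fin d → Fin m) (h : ℕ) : stackPoint x h (Fin.last d) = h := by
  simp [stackPoint]

@[simp]
theorem stackPoint_castSucc (x : Fin d → Fin m) (h : ℕ) (k : Fin d) :
    stackPoint x h k.castSucc = (x k : ℕ) := by
  simp [stackPoint]

theorem stackPoint_inj {x y : Fin d → Fin m} {h k : ℕ} :
    stackPoint x h = stackPoint y k ↔ x = y ∧ h = k := by
  constructor
  · intro e
    constructor
    · ext i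
      have := congrFun e i.castSucc
      simpa using this
    · have := congrFun e (Fin.last d)
      simpa using this
  · rintro ⟨rfl, rfl⟩
    rfl

/-- The embedding of the grid as the layer at height `h`. -/
def layerHom (d m h : ℕ) : gridGraph d m →g lattice (d + 1) where
  toFun x := stackPoint x h
  map_rel' := by
    intro x y hxy
    change ∑ i, |stackPoint x h i - stackPoint y h i| = 1
    rw [Fin.sum_univ_castSucc]
    have h : ∑ i, |((x i : ℕ) : ℤ) - (y i : ℕ)| = 1 := hxy
    simpa using h

theorem lattice_adj_stackPoint_succ (x : Fin d → Fin m) (h : ℕ) :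
    (lattice (d + 1)).Adj (stackPoint x h) (stackPoint x (h + 1)) := by
  change ∑ i, |stackPoint x h i - stackPoint x (h + 1) i| = 1
  rw [Fin.sum_univ_castSucc]
  simp

/-- Products of `k` layer routable permutations are routed by edge-disjoint walks from height `0`
to height `k`. -/
theorem exists_stacked_walks (k : ℕ) :
    ∀ π ∈ layerRoutable d m ^ k,
      ∃ p : ∀ x, (lattice (d + 1)).Walk (stackPoint x 0) (stackPoint (π x) k),
        (∀ x, ∀ v ∈ (p x).support, ∃ y : Fin d → Fin m, ∃ h ≤ k, v = stackPoint y h) ∧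
        (∀ x, ∀ e ∈ (p x).edges, ∃ y : Fin d → Fin m, ∃ h < k, stackPoint y h ∈ e) ∧
        ∀ x y, x ≠ y → (p x).edges.Disjoint (p y).edges := by
  induction k with
  | zero =>
    intro π hπ
    rw [pow_zero, Set.mem_one] at hπ
    subst hπ
    refine ⟨fun x => SimpleGraph.Walk.nil.copy rfl (by rw [Equiv.Perm.one_apply]), ?_, ?_, ?_⟩
    · intro x v hv
      rw [SimpleGraph.Walk.support_copy, SimpleGraph.Walk.support_nil, List.mem_singleton] at hv
      exact ⟨x, 0, le_rfl, hv⟩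
    · simp
    · simp
  | succ k ih =>
    intro π hπ
    rw [pow_succ'] at hπ
    obtain ⟨σ, ⟨q, hq⟩, π, hπ', rfl⟩ := Set.mem_mul.1 hπ
    obtain ⟨p, hp1, hp2, hp3⟩ := ih π hπ'
    obtain ⟨w, hws, hwe⟩ : ∃ w : ∀ x, (lattice (d + 1)).Walk (stackPoint x k) (stackPoint (σ x) k),
        (∀ x, (w x).support = (q x).support.map fun y => stackPoint y k) ∧
        ∀ x, (w x).edges = (q x).edges.map (Sym2.map fun y => stackPoint y k) :=
      ⟨fun x => (q x).map (layerHom d m k), fun x => SimpleGraph.Walk.support_map _ _,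
        fun x => SimpleGraph.Walk.edges_map _ _⟩
    -- The old walk up to height `k`, then the routing of `σ` inside layer `k`, then one vertical
    -- edge.
    let u : ∀ x, (lattice (d + 1)).Walk (stackPoint x 0) (stackPoint (σ (π x)) (k + 1)) :=
      fun x => ((p x).append (w (π x))).concat (lattice_adj_stackPoint_succ _ k)
    have hqe : ∀ x, ∀ e ∈ (w x).edges, ∀ v ∈ e,
        ∃ y : Fin d → Fin m, v = stackPoint y k := by
      intro x e he v hv
      have := SimpleGraph.Walk.mem_support_of_mem_edges he hv
      rw [hws, List.mem_map] at this
      obtain ⟨y, -, rfl⟩ := this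
      exact ⟨y, rfl⟩
    have hue : ∀ x e, e ∈ (u x).edges ↔ e ∈ (p x).edges ∨
        e ∈ (w (π x)).edges ∨
        e = s(stackPoint (σ (π x)) k, stackPoint (σ (π x)) (k + 1)) := by
      intro x e
      simp only [u, SimpleGraph.Walk.edges_concat, SimpleGraph.Walk.edges_append,
        List.concat_eq_append, List.mem_append, List.mem_singleton, or_assoc]
    -- Every old edge has an end strictly below height `k`. This part of the induction hypothesis
    -- separates it from the new layer and from the new vertical edges.
    have hpq : ∀ (x y : Fin d → Fin m) e, e ∈ (p x).edges →
        ¬ e ∈ (w y).edges := by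
      intro x y e h1 h2
      obtain ⟨z, h, hlt, hz⟩ := hp2 x e h1
      obtain ⟨z', hz'⟩ := hqe y e h2 _ hz
      exact hlt.ne (stackPoint_inj.1 hz').2
    have hpv : ∀ (x y : Fin d → Fin m) e, e ∈ (p x).edges →
        e ≠ s(stackPoint y k, stackPoint y (k + 1)) := by
      rintro x y e h1 rfl
      obtain ⟨z, h, hlt, hz⟩ := hp2 x _ h1
      rw [Sym2.mem_iff, stackPoint_inj, stackPoint_inj] at hz
      omega
    have hqv : ∀ (x y : Fin d → Fin m) e, e ∈ (w x).edges →
        e ≠ s(stackPoint y k, stackPoint y (k + 1)) := by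
      rintro x y e h1 rfl
      obtain ⟨z, hz⟩ := hqe x _ h1 _ (Sym2.mem_mk_right _ _)
      rw [stackPoint_inj] at hz
      omega
    change ∃ p : ∀ x, (lattice (d + 1)).Walk (stackPoint x 0) (stackPoint (σ (π x)) (k + 1)),
      (∀ x, ∀ v ∈ (p x).support, ∃ y : Fin d → Fin m, ∃ h ≤ k + 1, v = stackPoint y h) ∧
      (∀ x, ∀ e ∈ (p x).edges, ∃ y : Fin d → Fin m, ∃ h < k + 1, stackPoint y h ∈ e) ∧
      ∀ x y, x ≠ y → (p x).edges.Disjoint (p y).edges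
    refine ⟨u, ?_, ?_, ?_⟩
    · intro x v hv
      simp only [u, SimpleGraph.Walk.support_concat, SimpleGraph.Walk.mem_support_append_iff,
        List.mem_append, List.mem_singleton, hws, List.mem_map] at hv
      rcases hv with (hv | ⟨y, -, rfl⟩) | rfl
      · obtain ⟨y, h, hle, rfl⟩ := hp1 x v hv
        exact ⟨y, h, hle.trans k.le_succ, rfl⟩
      · exact ⟨y, k, k.le_succ, rfl⟩
      · exact ⟨_, k + 1, le_rfl, rfl⟩
    · intro x e he
      rcases (hue x e).1 he with he | he | rfl
      · obtain ⟨y, h, hlt, hy⟩ := hp2 x e he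
        exact ⟨y, h, hlt.trans k.lt_succ_self, hy⟩
      · induction e using Sym2.ind with
        | _ v w =>
          obtain ⟨y, rfl⟩ := hqe _ _ he v (Sym2.mem_mk_left _ _)
          exact ⟨y, k, k.lt_succ_self, Sym2.mem_mk_left _ _⟩
      · exact ⟨_, k, k.lt_succ_self, Sym2.mem_mk_left _ _⟩
    · intro x y hxy e hex hey
      rw [hue] at hex hey
      rcases hex with hex | hex | hex <;> rcases hey with hey | hey | hey
      · exact hp3 x y hxy hex hey
      · exact hpq _ _ _ hex hey
      · exact hpv _ _ _ hex hey
      · exact hpq _ _ _ hey hex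
      · rw [hwe, List.mem_map] at hex hey
        obtain ⟨e1, he1, rfl⟩ := hex
        obtain ⟨e2, he2, heq⟩ := hey
        have hinj : Function.Injective fun y : Fin d → Fin m => stackPoint y k := fun a b hab =>
          (stackPoint_inj.1 hab).1
        have := Sym2.map.injective hinj heq
        subst this
        exact hq _ _ (fun h => hxy (π.injective h)) he1 he2
      · exact hqv _ _ _ hex hey
      · exact hpv _ _ _ hey hex
      · exact hqv _ _ _ hey hex
      · rw [hex, Sym2.eq_iff, stackPoint_inj, stackPoint_inj, stackPoint_inj,
          stackPoint_inj] at hey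
        rcases hey with hey | hey
        · exact hxy (π.injective (σ.injective hey.1.1))
        · omega

end Stacking

/-- Two injections with the same domain into a finite type differ by a permutation. -/
theorem exists_perm_apply_eq {E V : Type*} [Finite V] {f g : E → V}
    (hf : Function.Injective f) (hg : Function.Injective g) :
    ∃ π : Equiv.Perm V, ∀ e, π (f e) = g e := by
  classical
  have := Fintype.ofFinite V
  let φ : {v // v ∈ Set.range f} ≃ {v // v ∈ Set.range g} :=
    (Equiv.ofInjective f hf).symm.trans (Equiv.ofInjective g hg)
  refine ⟨φ.extendSubtype, fun e => ?_⟩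
  rw [Equiv.extendSubtype_apply_of_mem _ _ ⟨e, rfl⟩]
  simp [φ, Equiv.ofInjective_symm_apply]

/-- Edge-disjoint routing: the box `[m]^d × {0, …, 6 d m}` contains edge-disjoint paths from any
points of its bottom to any points of its top. -/
theorem exists_disjoint_paths {d m : ℕ} (hd : 2 ≤ d) {E : Type*} {f g : E → (Fin d → Fin m)}
    (hf : Function.Injective f) (hg : Function.Injective g) :
    ∃ p : ∀ e, (lattice (d + 1)).Walk (stackPoint (f e) 0) (stackPoint (g e) (6 * d * m)),
      (∀ e, (p e).IsPath) ∧ (∀ e, ∀ v ∈ (p e).support, v ∈ box (d + 1) m (6 * d * m)) ∧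
      ∀ e e', e ≠ e' → (p e).edges.Disjoint (p e').edges := by
  obtain ⟨π, hπ⟩ := exists_perm_apply_eq hf hg
  obtain ⟨p, hp1, -, hp3⟩ := exists_stacked_walks _ π (mem_layerRoutable_pow hd π)
  -- Cutting loops turns walks into paths and only removes vertices and edges, so confinement and
  -- disjointness survive.
  refine ⟨fun e => ((p (f e)).copy rfl (by rw [hπ])).bypass,
    fun e => SimpleGraph.Walk.bypass_isPath _, ?_, ?_⟩
  · intro e v hv
    have := SimpleGraph.Walk.support_bypass_subset_support _ hv
    rw [SimpleGraph.Walk.support_copy] at this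
    obtain ⟨y, h, hle, rfl⟩ := hp1 _ v this
    constructor
    · intro i hi
      obtain ⟨j, rfl⟩ := Fin.exists_castSucc_eq.2 (show i ≠ Fin.last d by
        rintro rfl; simp at hi)
      simp
    · intro i hi
      have : i = Fin.last d := Fin.ext (by simpa using hi)
      subst this
      rw [stackPoint_last]
      exact ⟨by positivity, by exact_mod_cast hle⟩
  · intro e e' hne a h1 h2
    have h1 := SimpleGraph.Walk.edges_bypass_subset_edges _ h1
    have h2 := SimpleGraph.Walk.edges_bypass_subset_edges _ h2
    rw [SimpleGraph.Walk.edges_copy] at h1 h2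
    exact hp3 _ _ (fun h => hne (hf h)) h1 h2

end WireCode

/-! ### Existence of a run -/

namespace WireCode

open Finset

/-- Greedy colouring. -/
theorem exists_greedy_coloring {E : Type*} [Fintype E] [DecidableEq E] (k : ℕ)
    (C : E → E → Prop) [DecidableRel C] (hC : ∀ e f, C e f → C f e)
    (hk : ∀ e, #{f | f ≠ e ∧ C e f} < k) :
    ∃ c : E → Fin k, ∀ e f, C e f → e ≠ f → c e ≠ c f := by
  suffices h : ∀ s : Finset E, ∃ c : E → Fin k, ∀ e ∈ s, ∀ f ∈ s, C e f → e ≠ f → c e ≠ c f by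
    obtain ⟨c, hc⟩ := h univ
    exact ⟨c, fun e f => hc e (mem_univ _) f (mem_univ _)⟩
  intro s
  induction s using Finset.induction_on with
  | empty => exact ⟨fun e => ⟨0, (Nat.zero_le _).trans_lt (hk e)⟩, by simp⟩
  | insert a s ha ih =>
    obtain ⟨c, hc⟩ := ih
    obtain ⟨x, hx⟩ : ∃ x, x ∉ image c {f | f ≠ a ∧ C a f} := by
      by_contra! h
      have h1 := card_le_card (fun x _ => h x : (univ : Finset (Fin k)) ⊆ _)
      rw [card_univ, Fintype.card_fin] at h1
      exact absurd (h1.trans card_image_le) (hk a).not_ge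
    have hx' : ∀ f, C a f → f ≠ a → x ≠ c f := by
      rintro f h1 h2 rfl
      exact hx (mem_image_of_mem _ (by simp [h1, h2]))
    refine ⟨Function.update c a x, fun e he f hf hef hne => ?_⟩
    by_cases hea : e = a
    · subst hea
      rw [Function.update_self, Function.update_of_ne hne.symm]
      exact hx' f hef hne.symm
    · rw [Function.update_of_ne hea]
      by_cases hfa : f = a
      · subst hfa
        rw [Function.update_self]
        exact (hx' e (hC _ _ hef) hea).symm
      · rw [Function.update_of_ne hfa]
        exact hc e (mem_of_mem_insert_of_ne he hea) f (mem_of_mem_insert_of_ne hf hfa) hef hne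

namespace StabilizerCode

variable {n r : ℕ} {S : StabilizerCode n r} {w δ : ℕ}

theorem Pair.ext {e f : S.Pair} (h1 : e.qubit = f.qubit) (h2 : e.chk = f.chk) : e = f :=
  Subtype.ext (Prod.ext h1 h2)

open Classical in
theorem IsLDPC.card_pairs_qubit_le (h : S.IsLDPC w δ) (q : Fin n) :
    #{e : S.Pair | e.qubit = q} ≤ δ := by
  refine le_trans ?_ (h.2 q)
  refine card_le_card_of_injOn Pair.chk ?_ ?_
  · intro e he
    simp only [coe_filter, mem_univ, true_and, Set.mem_ofPred_eq] at he ⊢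
    rw [← he]
    exact e.2
  · intro e he f hf hef
    simp only [coe_filter, mem_univ, true_and, Set.mem_ofPred_eq] at he hf
    exact Pair.ext (he.trans hf.symm) hef

open Classical in
theorem IsLDPC.card_pairs_chk_le (h : S.IsLDPC w δ) (s : Fin r) :
    #{e : S.Pair | e.chk = s} ≤ w := by
  refine le_trans ?_ (h.1 s)
  refine card_le_card_of_injOn Pair.qubit ?_ ?_
  · intro e he
    simp only [coe_filter, mem_univ, true_and, Set.mem_ofPred_eq] at he ⊢
    rw [← he]
    exact e.2
  · intro e he f hf hef
    simp only [coe_filter, mem_univ, true_and, Set.mem_ofPred_eq] at he hf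
    exact Pair.ext hef (he.trans hf.symm)

/-- The qubit–check pairs of a code can be coloured by `w δ + 1` colours such that pairs of the
same colour share neither a qubit nor a check. -/
theorem IsLDPC.exists_coloring (h : S.IsLDPC w δ) :
    ∃ c : S.Pair → Fin (w * δ + 1), ∀ e f : S.Pair, c e = c f → e ≠ f →
      e.qubit ≠ f.qubit ∧ e.chk ≠ f.chk := by
  classical
  obtain ⟨c, hc⟩ := exists_greedy_coloring (E := S.Pair) (w * δ + 1)
    (fun e f => e.qubit = f.qubit ∨ e.chk = f.chk)
    (fun e f hef => hef.imp Eq.symm Eq.symm) (by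
      intro e
      have h1 : #(({f : S.Pair | f.qubit = e.qubit} : Finset S.Pair).erase e) + 1 ≤ δ := by
        rw [card_erase_add_one (by simp)]
        exact h.card_pairs_qubit_le _
      have h2 : #(({f : S.Pair | f.chk = e.chk} : Finset S.Pair).erase e) + 1 ≤ w := by
        rw [card_erase_add_one (by simp)]
        exact h.card_pairs_chk_le _
      have h3 : #{f : S.Pair | f ≠ e ∧ (e.qubit = f.qubit ∨ e.chk = f.chk)} ≤
          #(({f : S.Pair | f.qubit = e.qubit} : Finset S.Pair).erase e) +
          #(({f : S.Pair | f.chk = e.chk} : Finset S.Pair).erase e) := by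
        refine (card_le_card ?_).trans (card_union_le _ _)
        intro f hf
        simp only [mem_filter, mem_univ, true_and, mem_union, mem_erase] at hf ⊢
        rcases hf with ⟨h1, h2 | h2⟩
        · exact Or.inl ⟨h1, h2.symm⟩
        · exact Or.inr ⟨h1, h2.symm⟩
      -- If `a + 1 ≤ δ` and `b + 1 ≤ w`, then `w δ ≥ (a + 1) (b + 1) > a + b`, so a pair has fewer
      -- conflicts than there are colours.
      nlinarith)
  exact ⟨c, fun e f hef hne =>
    ⟨fun hq => hc e f (Or.inl hq) hne hef, fun hs => hc e f (Or.inr hs) hne hef⟩⟩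

end StabilizerCode

/-- The purpose of rounding up in `boxSide`: a layer has enough sites for all qubits, and likewise
for all checks. -/
theorem max_le_boxSide_pow (n r : ℕ) {d : ℕ} (hd : d ≠ 0) :
    max n r ≤ boxSide n r (d + 1) ^ d := by
  have h0 : (0 : ℝ) ≤ ((max n r : ℕ) : ℝ) := Nat.cast_nonneg _
  have h1 : ((max n r : ℕ) : ℝ) ^ (1 / (((d + 1 : ℕ) : ℝ) - 1)) ≤ boxSide n r (d + 1) :=
    Nat.le_ceil _
  have h2 : (1 / (((d + 1 : ℕ) : ℝ) - 1)) = (d : ℝ)⁻¹ := by push_cast; simp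
  rw [h2] at h1
  have h3 := pow_le_pow_left₀ (Real.rpow_nonneg h0 _) h1 d
  rw [Real.rpow_inv_natCast_pow h0 hd] at h3
  exact_mod_cast h3

theorem exists_injective_grid (n r : ℕ) {d : ℕ} (hd : d ≠ 0) {k : ℕ} (hk : k ≤ max n r) :
    ∃ a : Fin k → (Fin d → Fin (boxSide n r (d + 1))), Function.Injective a := by
  have : Fintype.card (Fin k) ≤ Fintype.card (Fin d → Fin (boxSide n r (d + 1))) := by
    simpa using hk.trans (max_le_boxSide_pow n r hd)
  obtain ⟨a⟩ := Function.Embedding.nonempty_of_card_le this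
  exact ⟨a, a.injective⟩

/-- The routing of the wire code construction is possible. -/
theorem nonempty_run {n r : ℕ} {S : StabilizerCode n r} {w δ : ℕ} (h : S.IsLDPC w δ) {d : ℕ}
    (hd : 2 ≤ d) : Nonempty (Run S (d + 1) (6 * d) w δ) := by
  have hd0 : d ≠ 0 := by omega
  obtain ⟨a, ha⟩ := exists_injective_grid n r hd0 (le_max_left n r)
  obtain ⟨b, hb⟩ := exists_injective_grid n r hd0 (le_max_right n r)
  obtain ⟨c, hc⟩ := h.exists_coloring
  have hmem : ∀ (x : Fin d → Fin (boxSide n r (d + 1))) (t : ℕ),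
      t ≤ 6 * d * boxSide n r (d + 1) → stackPoint x t ∈
        box (d + 1) (boxSide n r (d + 1)) (6 * d * boxSide n r (d + 1)) ∩ layer (d + 1) t := by
    intro x t ht
    refine ⟨⟨fun i hi => ?_, fun i hi => ?_⟩, fun i hi => ?_⟩
    · obtain ⟨j, rfl⟩ := Fin.exists_castSucc_eq.2 (show i ≠ Fin.last d by
        rintro rfl; simp at hi)
      simp
    · have : i = Fin.last d := Fin.ext (by simpa using hi)
      subst this
      rw [stackPoint_last]
      exact ⟨by positivity, by exact_mod_cast ht⟩
    · have : i = Fin.last d := Fin.ext (by simpa using hi)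
      subst this
      rw [stackPoint_last]
  -- Pairs of one colour have distinct qubits and distinct checks, so both end maps are injective
  -- and each colour class can be routed by itself.
  have key : ∀ κ, ∃ p : ∀ e : {e : S.Pair // c e = κ}, (lattice (d + 1)).Walk
      (stackPoint (a e.1.qubit) 0) (stackPoint (b e.1.chk) (6 * d * boxSide n r (d + 1))),
      (∀ e, (p e).IsPath) ∧ (∀ e, ∀ v ∈ (p e).support,
        v ∈ box (d + 1) (boxSide n r (d + 1)) (6 * d * boxSide n r (d + 1))) ∧
      ∀ e e', e ≠ e' → (p e).edges.Disjoint (p e').edges := by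
    intro κ
    refine exists_disjoint_paths hd (f := fun e : {e : S.Pair // c e = κ} => a e.1.qubit)
      (g := fun e => b e.1.chk) (fun e e' hee => ?_) (fun e e' hee => ?_)
    · by_contra hne
      exact (hc e.1 e'.1 (e.2.trans e'.2.symm) fun h => hne (Subtype.ext h)).1 (ha hee)
    · by_contra hne
      exact (hc e.1 e'.1 (e.2.trans e'.2.symm) fun h => hne (Subtype.ext h)).2 (hb hee)
  choose p hp1 hp2 hp3 using key
  refine ⟨{
    qubitSite := fun q => stackPoint (a q) 0
    qubitSite_injective := fun q q' hq => ha (stackPoint_inj.1 hq).1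
    qubitSite_mem := fun q => hmem _ _ (Nat.zero_le _)
    checkSite := fun s => stackPoint (b s) (6 * d * boxSide n r (d + 1))
    checkSite_injective := fun s s' hs => hb (stackPoint_inj.1 hs).1
    checkSite_mem := fun s => hmem _ _ le_rfl
    color := c
    color_valid := hc
    route := fun e => p (c e) ⟨e, rfl⟩
    route_isPath := fun e => hp1 _ _
    route_mem := fun e => hp2 _ _
    route_disjoint := ?_ }⟩
  intro e f hef hne
  have : ∀ κ (h : c f = κ), (p (c f) ⟨f, rfl⟩).edges = (p κ ⟨f, h⟩).edges := by
    rintro _ rfl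
    rfl
  rw [this _ hef.symm]
  exact hp3 _ _ _ fun h => hne (congrArg Subtype.val h)

end WireCode

/-! ### Weights, degrees and positions of the checks -/

namespace WireCode

open Finset

namespace StabilizerCode

variable {n r : ℕ} {S : StabilizerCode n r}

theorem BranchNext.left_unique {e e' f : S.Pair} (h : BranchNext e f) (h' : BranchNext e' f) :
    e = e' := by
  have hq : e.qubit = e'.qubit := h.1.1.trans h'.1.1.symm
  have hs : SameBranch e e' := ⟨hq, h.1.2.trans h'.1.2.symm⟩
  refine Pair.ext hq (le_antisymm ?_ ?_)
  · exact not_lt.1 fun hlt => h'.2.2 e ⟨hs.1.symm, hs.2.symm⟩ ⟨hlt, h.2.1⟩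
  · exact not_lt.1 fun hlt => h.2.2 e' hs ⟨hlt, h'.2.1⟩

theorem BranchNext.right_unique {e f f' : S.Pair} (h : BranchNext e f) (h' : BranchNext e f') :
    f = f' := by
  refine Pair.ext (h.1.1.symm.trans h'.1.1) (le_antisymm ?_ ?_)
  · exact not_lt.1 fun hlt => h.2.2 f' h'.1 ⟨h'.2.1, hlt⟩
  · exact not_lt.1 fun hlt => h'.2.2 f h.1 ⟨h.2.1, hlt⟩

theorem CheckNext.left_unique {e e' f : S.Pair} (h : CheckNext e f) (h' : CheckNext e' f) :
    e = e' := by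
  have hc : e.chk = e'.chk := h.1.trans h'.1.symm
  refine Pair.ext (le_antisymm ?_ ?_) hc
  · exact not_lt.1 fun hlt => h'.2.2 e hc ⟨hlt, h.2.1⟩
  · exact not_lt.1 fun hlt => h.2.2 e' hc.symm ⟨hlt, h'.2.1⟩

theorem CheckNext.right_unique {e f f' : S.Pair} (h : CheckNext e f) (h' : CheckNext e f') :
    f = f' := by
  refine Pair.ext (le_antisymm ?_ ?_) (h.1.symm.trans h'.1)
  · exact not_lt.1 fun hlt => h.2.2 f' h'.1.symm ⟨h'.2.1, hlt⟩
  · exact not_lt.1 fun hlt => h'.2.2 f h.1.symm ⟨h.2.1, hlt⟩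

theorem IsBranchStart.unique {e f : S.Pair} (he : IsBranchStart e) (hf : IsBranchStart f)
    (h : SameBranch e f) : e = f :=
  Pair.ext h.1 (le_antisymm (he f h) (hf e ⟨h.1.symm, h.2.symm⟩))

end StabilizerCode

/-- Names an object that may fail to exist, such as a predecessor on a branch, with `a₀` as default.
Counting by a list of candidates then needs no case distinction on existence. -/
theorem exists_forall_eq_of_unique {α : Type*} (P : α → Prop) (a₀ : α)
    (h : ∀ a b, P a → P b → a = b) : ∃ a, ∀ b, P b → b = a := by
  by_cases hP : ∃ a, P a
  · obtain ⟨a, ha⟩ := hP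
    exact ⟨a, fun b hb => h b a hb ha⟩
  · exact ⟨a₀, fun b hb => (hP ⟨b, hb⟩).elim⟩

theorem card_le_three_of_forall {α : Type*} {s : Finset α} (a b c : α)
    (h : ∀ x ∈ s, x = a ∨ x = b ∨ x = c) : #s ≤ 3 := by
  classical
  refine (card_le_card (t := {a, b, c}) fun x hx => ?_).trans card_le_three
  simpa using h x hx

namespace Run

open StabilizerCode

variable {n r : ℕ} {S : StabilizerCode n r} {D c w δ : ℕ} (R : Run S D c w δ)

theorem weight_singleX (v : R.Qubit) : weight (R.singleX v) ≤ 1 := by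
  classical
  refine (card_le_card (t := {v}) fun u hu => ?_).trans (card_singleton v).le
  rw [mem_filter] at hu
  by_contra h
  exact hu.2 (if_neg (by simpa using h))

theorem weight_copyCheck (f : S.Pair) : weight (R.copyCheck f) ≤ 3 := by
  obtain ⟨e₀, he₀⟩ := exists_forall_eq_of_unique (fun e => BranchNext e f) f
    fun a b ha hb => ha.left_unique hb
  refine card_le_three_of_forall (.data f.qubit) (.copy f) (.copy e₀) fun u hu => ?_
  rw [mem_filter] at hu
  rcases u with q | e | ⟨e, t⟩ | l <;> simp only [copyCheck] at hu
  · by_cases h : q = f.qubit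
    · simp [h]
    · simp [h] at hu
  · by_cases h : e = f ∨ BranchNext e f
    · rcases h with h | h
      · simp [h]
      · simp [he₀ e h]
    · simp [h] at hu
  · simp at hu
  · simp at hu

theorem weight_wireCheck (f : S.Pair) (t : Fin (R.numVerts f)) : weight (R.wireCheck f t) ≤ 3 := by
  -- The subtraction truncates: for `t = 0` the last two candidates coincide.
  refine card_le_three_of_forall (.copy f) (.wire f t) (.wire f ⟨t - 1, by omega⟩) fun u hu => ?_
  rw [mem_filter] at hu
  rcases u with q | e | ⟨e, u⟩ | l <;> simp only [wireCheck] at hu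
  · simp at hu
  · by_cases h : e = f
    · simp [h]
    · simp [h] at hu
  · by_cases h : e = f ∧ ((u : ℕ) = t ∨ (u : ℕ) + 1 = t)
    · obtain ⟨rfl, h | h⟩ := h
      · right; left
        rw [Fin.ext h]
      · right; right
        congr 1
        ext
        simp only
        omega
    · simp [h] at hu
  · simp at hu

theorem weight_junctionCheck (f : S.Pair) : weight (R.junctionCheck f) ≤ 3 := by
  obtain ⟨v₁, h₁⟩ := exists_forall_eq_of_unique
    (fun v => ∃ l : Link S, l.1.1 = f ∧ v = Qubit.link (R := R) l) (.copy f) (by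
      rintro _ _ ⟨⟨⟨e, e'⟩, h⟩, rfl, rfl⟩ ⟨⟨⟨_, e''⟩, h'⟩, rfl, rfl⟩
      simp only at h h'
      cases h.right_unique h'
      rfl)
  obtain ⟨v₂, h₂⟩ := exists_forall_eq_of_unique
    (fun v => ∃ l : Link S, l.1.2 = f ∧ v = Qubit.link (R := R) l) (.copy f) (by
      rintro _ _ ⟨⟨⟨e, e'⟩, h⟩, rfl, rfl⟩ ⟨⟨⟨e'', _⟩, h'⟩, rfl, rfl⟩
      simp only at h h'
      cases h.left_unique h'
      rfl)
  refine card_le_three_of_forall (.wire f ⟨R.numVerts f - 1, Nat.sub_lt (Nat.succ_pos _) one_pos⟩)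
    v₁ v₂ fun u hu => ?_
  rw [mem_filter] at hu
  rcases u with q | e | ⟨e, u⟩ | l <;> simp only [junctionCheck] at hu
  · simp at hu
  · simp at hu
  · by_cases h : e = f ∧ (u : ℕ) + 1 = R.numVerts f
    · obtain ⟨rfl, h⟩ := h
      left
      congr 1
      ext
      simp only
      omega
    · simp [h] at hu
  · by_cases h : l.1.1 = f ∨ l.1.2 = f
    · rcases h with h | h
      · exact Or.inr (Or.inl (h₁ _ ⟨l, h, rfl⟩))
      · exact Or.inr (Or.inr (h₂ _ ⟨l, h, rfl⟩))
    · simp [h] at hu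

theorem weight_gaugeCheck_le (i : R.CheckIndex) : weight (R.gaugeCheck i) ≤ 3 := by
  rcases i with (f | ⟨f, t⟩ | f) | (e | ⟨e, t⟩ | l)
  · exact R.weight_copyCheck f
  · exact R.weight_wireCheck f t
  · exact R.weight_junctionCheck f
  all_goals exact (R.weight_singleX _).trans (by norm_num)

/-- The multi-qubit checks of the wire code are not single-qubit ones. -/
theorem exists_eq_inl_of_two_le_weight {i : R.CheckIndex} (h : 2 ≤ weight (R.gaugeCheck i)) :
    ∃ j, i = .inl j := by
  rcases i with j | (e | ⟨e, t⟩ | l)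
  · exact ⟨j, rfl⟩
  all_goals exact absurd (h.trans (R.weight_singleX _)) (by norm_num)

/-- A data qubit meets the start of at most one branch for each of the three Paulis. A copy qubit
meets its own branch check, the next one and the start of its route; a wire qubit meets its own
route check, the next one and possibly a junction; a link meets two junctions. -/
theorem degree_le (v : R.Qubit) : degree R.gaugeCheck v ≤ 3 := by
  classical
  rcases v with q | e | ⟨e, t⟩ | l
  · have hcard : #({p : ZMod 2 × ZMod 2 | p ≠ 0} : Finset (ZMod 2 × ZMod 2)) = 3 := by decide
    rw [← hcard]
    refine card_le_card_of_injOn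
      (fun i => match i with | .inl (.inl f) => f.pauli | _ => 0) ?_ ?_
    · intro i hi
      simp only [coe_filter, mem_univ, true_and, Set.mem_ofPred_eq] at hi
      obtain ⟨j, rfl⟩ := R.exists_eq_inl_of_two_le_weight hi.1
      rcases j with f | ⟨f, t⟩ | f
      · simp only [coe_filter, mem_univ, true_and, Set.mem_ofPred_eq]
        exact f.2
      · exact absurd rfl hi.2
      · exact absurd rfl hi.2
    · intro i hi i' hi' h
      simp only [coe_filter, mem_univ, true_and, Set.mem_ofPred_eq] at hi hi'
      obtain ⟨j, rfl⟩ := R.exists_eq_inl_of_two_le_weight hi.1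
      obtain ⟨j', rfl⟩ := R.exists_eq_inl_of_two_le_weight hi'.1
      rcases j with f | ⟨f, t⟩ | f
      · rcases j' with f' | ⟨f', t⟩ | f'
        · have h1 : q = f.qubit ∧ IsBranchStart f := by
            by_contra h1
            exact hi.2 (if_neg h1)
          have h2 : q = f'.qubit ∧ IsBranchStart f' := by
            by_contra h2
            exact hi'.2 (if_neg h2)
          rw [h1.2.unique h2.2 ⟨h1.1.symm.trans h2.1, h⟩]
        · exact absurd rfl hi'.2
        · exact absurd rfl hi'.2
      · exact absurd rfl hi.2
      · exact absurd rfl hi.2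
  · obtain ⟨f₀, hf₀⟩ := exists_forall_eq_of_unique (fun f => BranchNext e f) e
      fun a b ha hb => ha.right_unique hb
    refine card_le_three_of_forall (.inl (.inl e)) (.inl (.inl f₀))
      (.inl (.inr (.inl ⟨e, ⟨0, Nat.succ_pos _⟩⟩))) fun i hi => ?_
    rw [mem_filter] at hi
    obtain ⟨j, rfl⟩ := R.exists_eq_inl_of_two_le_weight hi.2.1
    rcases j with f | ⟨f, t⟩ | f
    · have h : e = f ∨ BranchNext e f := by
        by_contra h
        exact hi.2.2 (if_neg h)
      rcases h with h | h
      · simp [h]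
      · simp [hf₀ f h]
    · have h : e = f ∧ (t : ℕ) = 0 := by
        by_contra h
        exact hi.2.2 (if_neg h)
      obtain ⟨rfl, h⟩ := h
      right; right
      congr 4
      exact Fin.ext h
    · exact absurd rfl hi.2.2
  · obtain ⟨t', ht'⟩ := exists_forall_eq_of_unique
      (fun u : Fin (R.numVerts e) => (t : ℕ) + 1 = u) t
      fun a b ha hb => Fin.ext (ha.symm.trans hb)
    refine card_le_three_of_forall (.inl (.inr (.inl ⟨e, t⟩)))
      (.inl (.inr (.inl ⟨e, t'⟩))) (.inl (.inr (.inr e))) fun i hi => ?_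
    rw [mem_filter] at hi
    obtain ⟨j, rfl⟩ := R.exists_eq_inl_of_two_le_weight hi.2.1
    rcases j with f | ⟨f, u⟩ | f
    · exact absurd rfl hi.2.2
    · have h : e = f ∧ ((t : ℕ) = u ∨ (t : ℕ) + 1 = u) := by
        by_contra h
        exact hi.2.2 (if_neg h)
      obtain ⟨rfl, h | h⟩ := h
      · left
        rw [Fin.ext h]
      · right; left
        rw [ht' u h]
    · have h : e = f ∧ (t : ℕ) + 1 = R.numVerts f := by
        by_contra h
        exact hi.2.2 (if_neg h)
      simp [h.1]
  · refine card_le_three_of_forall (.inl (.inr (.inr l.1.1))) (.inl (.inr (.inr l.1.2)))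
      (.inl (.inr (.inr l.1.2))) fun i hi => ?_
    rw [mem_filter] at hi
    obtain ⟨j, rfl⟩ := R.exists_eq_inl_of_two_le_weight hi.2.1
    rcases j with f | ⟨f, t⟩ | f
    · exact absurd rfl hi.2.2
    · exact absurd rfl hi.2.2
    · have h : l.1.1 = f ∨ l.1.2 = f := by
        by_contra h
        exact hi.2.2 (if_neg h)
      rcases h with h | h <;> simp [h]

theorem pos_eq_or_adj (i : R.CheckIndex) (p q : R.Qubit) (hp : R.gaugeCheck i p ≠ 0)
    (hq : R.gaugeCheck i q ≠ 0) : R.pos p = R.pos q ∨ (lattice D).Adj (R.pos p) (R.pos q) := by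
  have hX : ∀ v p : R.Qubit, R.singleX v p ≠ 0 → p = v := by
    intro v p h
    by_contra hne
    exact h (if_neg hne)
  rcases i with (f | ⟨f, t⟩ | f) | (e | ⟨e, t⟩ | l)
  · have key : ∀ p : R.Qubit, R.copyCheck f p ≠ 0 → R.pos p = R.qubitSite f.qubit := by
      rintro (q | e | ⟨e, t⟩ | l) h
      · have h' : q = f.qubit ∧ IsBranchStart f := by
          by_contra h'
          exact h (if_neg h')
        rw [← h'.1]
        rfl
      · have h' : e = f ∨ BranchNext e f := by
          by_contra h'
          exact h (if_neg h')
        rcases h' with rfl | h'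
        · rfl
        · rw [← h'.1.1]
          rfl
      · exact absurd rfl h
      · exact absurd rfl h
    exact Or.inl ((key p hp).trans (key q hq).symm)
  -- Only route checks extend over more than one site. For `t = 0` both vertices are the site of the
  -- qubit, which also holds the copy qubit.
  · have key : ∀ p : R.Qubit, R.wireCheck f t p ≠ 0 →
        R.pos p = (R.route f).getVert t ∨ R.pos p = (R.route f).getVert (t - 1) := by
      rintro (q | e | ⟨e, u⟩ | l) h
      · exact absurd rfl h
      · have h' : e = f ∧ (t : ℕ) = 0 := by
          by_contra h'
          exact h (if_neg h')
        obtain ⟨rfl, h'⟩ := h'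
        left
        rw [h', SimpleGraph.Walk.getVert_zero]
        rfl
      · have h' : e = f ∧ ((u : ℕ) = t ∨ (u : ℕ) + 1 = t) := by
          by_contra h'
          exact h (if_neg h')
        obtain ⟨rfl, h' | h'⟩ := h'
        · left
          rw [← h']
          rfl
        · right
          rw [← h', Nat.add_sub_cancel]
          rfl
      · exact absurd rfl h
    have hadj : (R.route f).getVert (t - 1) = (R.route f).getVert t ∨
        (lattice D).Adj ((R.route f).getVert (t - 1)) ((R.route f).getVert t) := by
      rcases Nat.eq_zero_or_pos (t : ℕ) with h0 | h0
      · left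
        rw [h0]
      · right
        have := (R.route f).adj_getVert_succ (i := t - 1) (by
          have : (t : ℕ) < (R.route f).length + 1 := t.2
          omega)
        rwa [Nat.sub_add_cancel h0] at this
    rcases key p hp with h1 | h1 <;> rcases key q hq with h2 | h2 <;> rw [h1, h2]
    · exact Or.inl rfl
    · exact hadj.imp Eq.symm SimpleGraph.Adj.symm
    · exact hadj
    · exact Or.inl rfl
  · have key : ∀ p : R.Qubit, R.junctionCheck f p ≠ 0 → R.pos p = R.checkSite f.chk := by
      rintro (q | e | ⟨e, t⟩ | l) h
      · exact absurd rfl h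
      · exact absurd rfl h
      · have h' : e = f ∧ (t : ℕ) + 1 = R.numVerts f := by
          by_contra h'
          exact h (if_neg h')
        obtain ⟨rfl, h'⟩ := h'
        have : (t : ℕ) = (R.route e).length := Nat.succ_injective h'
        change (R.route e).getVert t = _
        rw [this, SimpleGraph.Walk.getVert_length]
      · have h' : l.1.1 = f ∨ l.1.2 = f := by
          by_contra h'
          exact h (if_neg h')
        change R.checkSite l.1.1.chk = _
        rcases h' with h' | h'
        · rw [h']
        · rw [← h', l.2.1]
    exact Or.inl ((key p hp).trans (key q hq).symm)
  all_goals exact Or.inl (by rw [hX _ p hp, hX _ q hq])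

end Run

end WireCode

/-! ### Density and number of qubits -/

namespace WireCode

open Finset

/-- A lattice point has at most `3 ^ D` neighbours. -/
theorem card_le_of_forall_lattice_adj {D : ℕ} (x : Fin D → ℤ) {s : Finset (Fin D → ℤ)}
    (h : ∀ y ∈ s, (lattice D).Adj x y) : #s ≤ 3 ^ D := by
  have hc : #(Fintype.piFinset fun i => Icc (x i - 1) (x i + 1)) = 3 ^ D := by
    rw [Fintype.card_piFinset]
    simp only [Int.card_Icc]
    rw [prod_congr rfl fun i _ => show (x i + 1 + 1 - (x i - 1)).toNat = 3 by
      ring_nf; rfl]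
    simp
  rw [← hc]
  refine card_le_card fun y hy => Fintype.mem_piFinset.2 fun i => ?_
  have h1 : ∑ i, |x i - y i| = 1 := h y hy
  have h2 : |x i - y i| ≤ 1 := h1 ▸ single_le_sum (f := fun i => |x i - y i|)
    (fun i _ => abs_nonneg _) (mem_univ i)
  rw [abs_le] at h2
  rw [mem_Icc]
  omega

namespace Run

open StabilizerCode

variable {n r : ℕ} {S : StabilizerCode n r} {D c w δ : ℕ} (R : Run S D c w δ)

theorem boxSide_pos (R : Run S D c w δ) (hD : 2 ≤ D) (q : Fin n) : 0 < boxSide n r D := by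
  have := (R.qubitSite_mem q).1.1 ⟨0, by omega⟩ (by simp; omega)
  omega

/-- The ends lie at heights `0` and `c m > 0`. Consequently each vertex of a route lies on one of
its edges, which lets edge-disjointness limit the routes through a site. -/
theorem route_not_nil (hD : 2 ≤ D) (hc : 0 < c) (e : S.Pair) : ¬ (R.route e).Nil := by
  intro h
  have h1 := (R.qubitSite_mem e.qubit).2 ⟨D - 1, by omega⟩ (by simp; omega)
  have h2 := (R.checkSite_mem e.chk).2 ⟨D - 1, by omega⟩ (by simp; omega)
  rw [h.eq, h2] at h1
  have := Nat.mul_pos hc (R.boxSide_pos hD e.qubit)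
  rw [Nat.cast_inj] at h1
  omega

open Classical in
/-- Few routes pass through a lattice point. -/
theorem card_routes_through_le (hD : 2 ≤ D) (hc : 0 < c) (x : Fin D → ℤ) :
    #{e : S.Pair | x ∈ (R.route e).support} ≤ 3 ^ D * (w * δ + 1) := by
  have h := card_le_mul_card_image_of_maps_to (s := ({e : S.Pair | x ∈ (R.route e).support} :
    Finset S.Pair)) (t := univ) (f := R.color) (fun _ _ => mem_univ _) (3 ^ D) (by
      intro κ _
      -- Each route of the class through `x` selects a neighbour of `x` along one of its edges;
      -- edge-disjoint routes select different neighbours.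
      have hy : ∀ e ∈ ({e : S.Pair | x ∈ (R.route e).support} : Finset S.Pair),
          ∃ y, s(x, y) ∈ (R.route e).edges := by
        intro e he
        obtain ⟨a, ha, hxa⟩ := (SimpleGraph.Walk.mem_support_iff_exists_mem_edges_of_not_nil
          (R.route_not_nil hD hc e)).1 (mem_filter.1 he).2
        obtain ⟨y, rfl⟩ := hxa
        exact ⟨y, ha⟩
      choose! y hy using hy
      rw [← card_image_of_injOn (f := y)]
      · refine card_le_of_forall_lattice_adj x fun z hz => ?_
        obtain ⟨e, he, rfl⟩ := mem_image.1 hz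
        exact SimpleGraph.Walk.adj_of_mem_edges _ (hy e (mem_filter.1 he).1)
      · intro e he f hf hef
        rw [mem_coe, mem_filter] at he hf
        by_contra hne
        refine R.route_disjoint e f (he.2.trans hf.2.symm) hne (hy e he.1) ?_
        rw [hef]
        exact hy f hf.1)
  rwa [card_univ, Fintype.card_fin] at h

open Classical in
/-- Few qubits are placed at a lattice point. -/
theorem card_pos_eq_le (hS : S.IsLDPC w δ) (hD : 2 ≤ D) (hc : 0 < c) (x : Fin D → ℤ) :
    #{v | R.pos v = x} ≤ 1 + δ + 3 ^ D * (w * δ + 1) + w := by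
  have hsub : ({v | R.pos v = x} : Finset R.Qubit) ⊆
      image Qubit.data {q | R.qubitSite q = x} ∪
      image Qubit.copy {e | R.qubitSite e.qubit = x} ∪
      image (fun a : Σ e : S.Pair, Fin (R.numVerts e) => Qubit.wire a.1 a.2)
        {a | (R.route a.1).getVert a.2 = x} ∪
      image Qubit.link {l | R.checkSite l.1.1.chk = x} := by
    rintro (q | e | ⟨e, t⟩ | l) hv <;> rw [mem_filter] at hv <;> have hv := hv.2
    · simp only [mem_union, mem_image, mem_filter, mem_univ, true_and]
      exact Or.inl (Or.inl (Or.inl ⟨q, hv, rfl⟩))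
    · simp only [mem_union, mem_image, mem_filter, mem_univ, true_and]
      exact Or.inl (Or.inl (Or.inr ⟨e, hv, rfl⟩))
    · simp only [mem_union, mem_image, mem_filter, mem_univ, true_and]
      exact Or.inl (Or.inr ⟨⟨e, t⟩, hv, rfl⟩)
    · simp only [mem_union, mem_image, mem_filter, mem_univ, true_and]
      exact Or.inr ⟨l, hv, rfl⟩
  have h1 : #{q | R.qubitSite q = x} ≤ 1 := by
    refine card_le_one.2 fun a ha b hb => R.qubitSite_injective ?_
    rw [(mem_filter.1 ha).2, (mem_filter.1 hb).2]
  have h2 : #{e : S.Pair | R.qubitSite e.qubit = x} ≤ δ := by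
    by_cases h : ∃ q, R.qubitSite q = x
    · obtain ⟨q, rfl⟩ := h
      simp only [R.qubitSite_injective.eq_iff]
      exact hS.card_pairs_qubit_le q
    · rw [filter_eq_empty_iff.2 fun e _ he => h ⟨_, he⟩]
      simp
  have h3 : #{a : Σ e : S.Pair, Fin (R.numVerts e) | (R.route a.1).getVert a.2 = x} ≤
      3 ^ D * (w * δ + 1) := by
    -- A path visits `x` at most once, so wire qubits at `x` are counted by the routes through `x`.
    refine (card_le_card_of_injOn Sigma.fst ?_ ?_).trans (R.card_routes_through_le hD hc x)
    · rintro ⟨e, t⟩ ha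
      simp only [coe_filter, mem_univ, true_and, Set.mem_ofPred_eq] at ha ⊢
      rw [← ha]
      exact SimpleGraph.Walk.getVert_mem_support _ _
    · rintro ⟨e, t⟩ ha ⟨e', t'⟩ ha' h
      obtain rfl : e = e' := h
      simp only [coe_filter, mem_univ, true_and, Set.mem_ofPred_eq] at ha ha'
      have := (R.route_isPath e).getVert_injOn (Nat.lt_succ_iff.1 t.2) (Nat.lt_succ_iff.1 t'.2)
        (ha.trans ha'.symm)
      rw [Fin.ext this]
  have h4 : #{l : Link S | R.checkSite l.1.1.chk = x} ≤ w := by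
    by_cases h : ∃ s, R.checkSite s = x
    · obtain ⟨s, rfl⟩ := h
      refine (card_le_card_of_injOn (fun l : Link S => l.1.1) ?_ ?_).trans
        (hS.card_pairs_chk_le s)
      · intro l hl
        simp only [coe_filter, mem_univ, true_and, Set.mem_ofPred_eq] at hl ⊢
        exact R.checkSite_injective hl
      · rintro ⟨⟨a, b⟩, hl⟩ - ⟨⟨a', b'⟩, hl'⟩ - h
        obtain rfl : a = a' := h
        obtain rfl : b = b' := hl.right_unique hl'
        rfl
    · rw [filter_eq_empty_iff.2 fun l _ hl => h ⟨_, hl⟩]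
      simp
  refine (card_le_card hsub).trans ((card_union_le _ _).trans ?_)
  refine add_le_add ((card_union_le _ _).trans (add_le_add ((card_union_le _ _).trans
    (add_le_add ?_ ?_)) ?_)) ?_
  · exact card_image_le.trans h1
  · exact card_image_le.trans h2
  · exact card_image_le.trans h3
  · exact card_image_le.trans h4

theorem isLocalOn (hS : S.IsLDPC w δ) (hD : 2 ≤ D) (hc : 0 < c) :
    IsLocalOn (lattice D) (1 + δ + 3 ^ D * (w * δ + 1) + w) R.pos R.gaugeCheck := by
  classical
  refine ⟨fun x => ?_, fun i p q => R.pos_eq_or_adj i p q⟩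
  rw [Set.ncard_eq_toFinset_card', Set.toFinset_ofPred]
  exact R.card_pos_eq_le hS hD hc x

theorem pos_mem_box (v : R.Qubit) :
    R.pos v ∈ box D (boxSide n r D) (c * boxSide n r D) := by
  rcases v with q | e | ⟨e, t⟩ | l
  · exact (R.qubitSite_mem q).1
  · exact (R.qubitSite_mem _).1
  · exact R.route_mem e _ (SimpleGraph.Walk.getVert_mem_support _ _)
  · exact (R.checkSite_mem _).1

end Run

theorem card_box_le {d m h : ℕ} {s : Finset (Fin (d + 1) → ℤ)} (hs : ∀ x ∈ s, x ∈ box (d + 1) m h) :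
    #s ≤ m ^ d * (h + 1) := by
  have hc : #(Fintype.piFinset (Fin.snoc (α := fun _ => Finset ℤ)
      (fun _ : Fin d => Ico (0 : ℤ) m) (Icc (0 : ℤ) h))) = m ^ d * (h + 1) := by
    rw [Fintype.card_piFinset, Fin.prod_univ_castSucc]
    simp
  rw [← hc]
  refine card_le_card fun x hx => Fintype.mem_piFinset.2 fun i => ?_
  have hx := hs x hx
  induction i using Fin.lastCases with
  | last =>
    have := hx.2 (Fin.last d) (by simp)
    simpa using this
  | cast j =>
    have := hx.1 j.castSucc (by simp)
    simpa using this

/-- Every check chooses a qubit of its support, possible since no check is the identity, and a qubit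
is chosen at most `δ` times. This bounds the side of the box in terms of `n` alone. -/
theorem StabilizerCode.IsLDPC.numChecks_le {n r w δ : ℕ} {S : StabilizerCode n r}
    (hS : S.IsLDPC w δ) : r ≤ δ * n := by
  classical
  have h1 : ∀ s, ∃ q, S.check s q ≠ 0 := fun s => Function.ne_iff.1 (S.nontrivial s)
  choose q hq using h1
  have := card_le_mul_card_image_of_maps_to (s := (univ : Finset (Fin r))) (t := univ) (f := q)
    (fun _ _ => mem_univ _) δ (fun b _ => by
      refine (card_le_card fun s hs => ?_).trans (hS.2 b)
      rw [mem_filter] at hs ⊢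
      exact ⟨mem_univ _, hs.2 ▸ hq s⟩)
  simpa using this

/-- The number of lattice points of the routing box. -/
theorem box_volume_le {n r c δ d : ℕ} (hc : 0 < c) (hd : d ≠ 0) (hr : r ≤ δ * n) :
    (boxSide n r (d + 1) : ℝ) ^ d * (c * boxSide n r (d + 1) + 1) ≤
      (δ + 3) ^ (d + 1) * (c * (n : ℝ) ^ (((d + 1 : ℕ) : ℝ) / (((d + 1 : ℕ) : ℝ) - 1))) := by
  have he : ((d + 1 : ℕ) : ℝ) - 1 = d := by push_cast; ring
  have hd' : (d : ℝ) ≠ 0 := Nat.cast_ne_zero.2 hd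
  rcases Nat.eq_zero_or_pos n with rfl | hn
  -- Without qubits there are no checks either, and the box has side `0`.
  · have h0 : boxSide 0 r (d + 1) = 0 := by
      have : r = 0 := by simpa using hr
      subst this
      rw [boxSide, he]
      simp [Real.zero_rpow (inv_ne_zero hd')]
    rw [h0, Nat.cast_zero, zero_pow hd, zero_mul]
    positivity
  set y : ℝ := (n : ℝ) ^ (1 / (d : ℝ)) with hy
  have hn1 : (1 : ℝ) ≤ n := by exact_mod_cast hn
  have hy1 : 1 ≤ y := Real.one_le_rpow hn1 (by positivity)
  have hc1 : (1 : ℝ) ≤ c := by exact_mod_cast hc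
  have hyd : (n : ℝ) ^ (((d + 1 : ℕ) : ℝ) / (((d + 1 : ℕ) : ℝ) - 1)) = y ^ (d + 1) := by
    rw [he, hy, ← Real.rpow_natCast, ← Real.rpow_mul (by positivity)]
    congr 1
    ring
  -- The factor `(δ + 1) ^ (1 / d)` is at most `δ + 1`, and the `1` lost to rounding up is at most
  -- `y`. The next bound spends another unit of `c y` on the extra layer at the top.
  have hm : (boxSide n r (d + 1) : ℝ) ≤ (δ + 2) * y := by
    have h1 : (boxSide n r (d + 1) : ℝ) ≤
        ((max n r : ℕ) : ℝ) ^ (1 / (((d + 1 : ℕ) : ℝ) - 1)) + 1 :=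
      (Nat.ceil_lt_add_one (by positivity)).le
    have h2 : ((max n r : ℕ) : ℝ) ≤ (δ + 1) * n := by
      have : max n r ≤ (δ + 1) * n := max_le (by nlinarith) (by nlinarith)
      exact_mod_cast this
    have h3 : ((max n r : ℕ) : ℝ) ^ (1 / (((d + 1 : ℕ) : ℝ) - 1)) ≤ (δ + 1) * y := by
      rw [he]
      refine (Real.rpow_le_rpow (by positivity) h2 (by positivity)).trans ?_
      rw [Real.mul_rpow (by positivity) (by positivity)]
      refine mul_le_mul_of_nonneg_right ?_ (by positivity)
      refine Real.rpow_le_self_of_one_le (by linarith [δ.cast_nonneg (α := ℝ)]) ?_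
      rw [div_le_one (by positivity)]
      exact_mod_cast Nat.one_le_iff_ne_zero.2 hd
    linarith
  have hm' : c * (boxSide n r (d + 1) : ℝ) + 1 ≤ c * ((δ + 3) * y) := by
    have : (1 : ℝ) ≤ c * y := one_le_mul_of_one_le_of_one_le hc1 hy1
    nlinarith [mul_le_mul_of_nonneg_left hm (zero_le_one.trans hc1)]
  rw [hyd]
  calc (boxSide n r (d + 1) : ℝ) ^ d * (c * boxSide n r (d + 1) + 1)
      ≤ ((δ + 3) * y) ^ d * (c * ((δ + 3) * y)) := by
        refine mul_le_mul (pow_le_pow_left₀ (by positivity) (hm.trans ?_) d) hm'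
          (by positivity) (by positivity)
        refine mul_le_mul_of_nonneg_right (by linarith) (by positivity)
    _ = (δ + 3) ^ (d + 1) * (c * y ^ (d + 1)) := by rw [mul_pow]; ring

/-- All qubits lie in the box, so their number is at most the density times its volume. -/
theorem Run.card_qubit_le {n r c w δ d : ℕ} {S : StabilizerCode n r} (hS : S.IsLDPC w δ)
    (hd : 2 ≤ d) (hc : 0 < c) (R : Run S (d + 1) c w δ) :
    (Fintype.card R.Qubit : ℝ) ≤
      ((1 + δ + 3 ^ (d + 1) * (w * δ + 1) + w) * (δ + 3) ^ (d + 1) : ℕ) *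
        (c * (n : ℝ) ^ (((d + 1 : ℕ) : ℝ) / (((d + 1 : ℕ) : ℝ) - 1))) := by
  classical
  have h1 := card_le_mul_card_image_of_maps_to (s := (univ : Finset R.Qubit))
    (t := univ.image R.pos) (f := R.pos) (fun v _ => mem_image_of_mem _ (mem_univ v)) _
    (fun x _ => R.card_pos_eq_le hS (by omega) hc x)
  have h2 := h1.trans (Nat.mul_le_mul_left _ (card_box_le (s := univ.image R.pos) (by
    intro x hx
    obtain ⟨v, -, rfl⟩ := mem_image.1 hx
    exact R.pos_mem_box v)))
  rw [card_univ] at h2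
  have h3 := box_volume_le hc (by omega : d ≠ 0) hS.numChecks_le
  calc (Fintype.card R.Qubit : ℝ) ≤ _ := Nat.cast_le.2 h2
    _ = ((1 + δ + 3 ^ (d + 1) * (w * δ + 1) + w : ℕ) : ℝ) *
        ((boxSide n r (d + 1) : ℝ) ^ d * (c * boxSide n r (d + 1) + 1)) := by push_cast; ring
    _ ≤ _ := mul_le_mul_of_nonneg_left h3 (Nat.cast_nonneg _)
    _ = _ := by push_cast; ring

end WireCode

/-! ### Reductions between subsystem codes -/

namespace WireCode

section Reduction

variable {Q Q' : Type} [Fintype Q] [Fintype Q'] {ι κ : Type}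

/-- The commutator with a fixed operator, as a linear map. -/
def commutatorLinear (a : Pauli Q) : Pauli Q →ₗ[ZMod 2] ZMod 2 where
  toFun b := commutator a b
  map_add' b b' := by
    simp only [commutator, ← Finset.sum_add_distrib, Pi.add_apply, Prod.fst_add, Prod.snd_add]
    exact Finset.sum_congr rfl fun q _ => by ring
  map_smul' c b := by
    simp only [commutator, Pi.smul_apply, Prod.smul_fst, Prod.smul_snd, smul_eq_mul,
      RingHom.id_apply, Finset.mul_sum]
    exact Finset.sum_congr rfl fun q _ => by ring

theorem commutatorLinear_apply (a b : Pauli Q) : commutatorLinear a b = commutator a b := rfl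

/-- A reduction of the subsystem code with gauge checks `g` to the code with checks `s`: modulo
gauge operators every operator is equivalent to one supported on the embedded qubits `Q'`. -/
structure Reduction (g : ι → Pauli Q) (s : κ → Pauli Q') where
  /-- The equivalent operator on the qubits `Q'`. -/
  reduce : Pauli Q →ₗ[ZMod 2] Pauli Q'
  /-- The embedding of operators. -/
  embed : Pauli Q' →ₗ[ZMod 2] Pauli Q
  /-- The bare operator that acts in a prescribed way on the qubits `Q'`. -/
  bare : Pauli Q' → Pauli Q
  sub_embed_mem : ∀ a, a - embed (reduce a) ∈ gaugeGroup g
  reduce_check_mem : ∀ i, reduce (g i) ∈ gaugeGroup s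
  embed_check_mem : ∀ j, embed (s j) ∈ gaugeGroup g
  commutator_bare : ∀ a b, commutator (bare a) b = commutator a (reduce b)
  reduce_bare : ∀ a, reduce (bare a) = a
  commutator_reduce : ∀ a ∈ normalizer (gaugeGroup g), ∀ b,
    commutator (reduce a) b = commutator a (embed b)

namespace Reduction

variable {g : ι → Pauli Q} {s : κ → Pauli Q'} (φ : Reduction g s)

theorem reduce_mem_gaugeGroup {a : Pauli Q} (ha : a ∈ gaugeGroup g) :
    φ.reduce a ∈ gaugeGroup s := by
  have : gaugeGroup g ≤ (gaugeGroup s).comap φ.reduce :=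
    Submodule.span_le.2 (by rintro _ ⟨i, rfl⟩; exact φ.reduce_check_mem i)
  exact this ha

theorem embed_mem_gaugeGroup {a : Pauli Q'} (ha : a ∈ gaugeGroup s) :
    φ.embed a ∈ gaugeGroup g := by
  have : gaugeGroup s ≤ (gaugeGroup g).comap φ.embed :=
    Submodule.span_le.2 (by rintro _ ⟨i, rfl⟩; exact φ.embed_check_mem i)
  exact this ha

/-- For the nontrivial direction write `a` as the gauge operator `a - embed (reduce a)` plus `embed
(reduce a)`; the latter is gauge as soon as `reduce a` is. -/
theorem reduce_mem_gaugeGroup_iff {a : Pauli Q} :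
    φ.reduce a ∈ gaugeGroup s ↔ a ∈ gaugeGroup g := by
  refine ⟨fun h => ?_, φ.reduce_mem_gaugeGroup⟩
  have := (gaugeGroup g).add_mem (φ.sub_embed_mem a) (φ.embed_mem_gaugeGroup h)
  rwa [sub_add_cancel] at this

theorem reduce_mem_normalizer {a : Pauli Q} (ha : a ∈ normalizer (gaugeGroup g)) :
    φ.reduce a ∈ normalizer (gaugeGroup s) := fun b hb => by
  rw [φ.commutator_reduce a ha]
  exact ha _ (φ.embed_mem_gaugeGroup hb)

theorem bare_mem_normalizer {a : Pauli Q'} (ha : a ∈ normalizer (gaugeGroup s)) :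
    φ.bare a ∈ normalizer (gaugeGroup g) := fun b hb => by
  rw [φ.commutator_bare]
  exact ha _ (φ.reduce_mem_gaugeGroup hb)

/-- `reduce` induces an isomorphism of the quotients of bare logical operators: `bare` gives
surjectivity, and the kernel consists of the gauge operators in the normalizer. -/
theorem numLogicalQubits_eq (φ : Reduction g s) : numLogicalQubits g = numLogicalQubits s := by
  let ψ : normalizer (gaugeGroup g) →ₗ[ZMod 2]
      normalizer (gaugeGroup s) ⧸ (gaugeGroup s).submoduleOf (normalizer (gaugeGroup s)) :=
    (Submodule.mkQ _).comp (φ.reduce.restrict fun _ => φ.reduce_mem_normalizer)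
  have hsurj : Function.Surjective ψ := by
    intro x
    obtain ⟨⟨a, ha⟩, rfl⟩ := Submodule.mkQ_surjective _ x
    refine ⟨⟨φ.bare a, φ.bare_mem_normalizer ha⟩, ?_⟩
    refine congrArg (Submodule.mkQ _) (Subtype.ext ?_)
    exact φ.reduce_bare a
  have hker : LinearMap.ker ψ = (gaugeGroup g).submoduleOf (normalizer (gaugeGroup g)) := by
    ext ⟨a, ha⟩
    rw [LinearMap.mem_ker, LinearMap.comp_apply, Submodule.mkQ_apply,
      Submodule.Quotient.mk_eq_zero]
    exact φ.reduce_mem_gaugeGroup_iff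
  have := ((Submodule.quotEquivOfEq _ _ hker).symm.trans
    (ψ.quotKerEquivOfSurjective hsurj)).finrank_eq
  rw [numLogicalQubits, numLogicalQubits, this]

theorem reduce_mem_logicals {a : Pauli Q} (ha : a ∈ logicals g) : φ.reduce a ∈ logicals s := by
  refine ⟨?_, fun h => ha.2 (φ.reduce_mem_gaugeGroup_iff.1 h)⟩
  obtain ⟨x, hx, y, hy, rfl⟩ := Submodule.mem_sup.1 ha.1
  rw [map_add]
  exact Submodule.add_mem_sup (φ.reduce_mem_normalizer hx) (φ.reduce_mem_gaugeGroup hy)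

/-- `reduce` carries a dressed logical operator of least weight to a logical operator of the other
code. If there is none, the right side must be `⊤`, which requires `B ≠ 0`. -/
theorem distance_le {B : ℕ} (hB : B ≠ 0) (h : ∀ a, weight (φ.reduce a) ≤ B * weight a) :
    distance s ≤ B * distance g := by
  rcases (logicals g).eq_empty_or_nonempty with he | hne
  · have : distance g = ⊤ := by simp [distance, he]
    rw [this, ENat.mul_top (by exact_mod_cast hB)]
    exact le_top
  · obtain ⟨a, ha, hmin⟩ := Set.exists_min_image (logicals g) weight (Set.toFinite _) hne
    have h1 : distance g = weight a := by
      refine le_antisymm (iInf₂_le a ha) (le_iInf₂ fun b hb => ?_)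
      exact_mod_cast hmin b hb
    rw [h1]
    refine (iInf₂_le _ (φ.reduce_mem_logicals ha)).trans ?_
    exact_mod_cast h a

end Reduction

end Reduction

end WireCode

/-! ### Moving operators to the data qubits -/

namespace WireCode

open Finset StabilizerCode

namespace StabilizerCode

variable {n r : ℕ} {S : StabilizerCode n r}

/-- The action of a check on the single qubit of a pair. -/
def Pair.op (e : S.Pair) : Pauli (Fin n) := Pi.single e.qubit e.pauli

/-- The restriction of the check of a pair to the qubits up to the one of this pair. -/
def Pair.initialOp (e : S.Pair) : Pauli (Fin n) := fun q =>
  if q ≤ e.qubit then S.check e.chk q else 0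

theorem exists_branchNext {f : S.Pair} (h : ¬ IsBranchStart f) : ∃ e, BranchNext e f := by
  classical
  simp only [IsBranchStart, not_forall, not_le] at h
  obtain ⟨g, hg, hlt⟩ := h
  obtain ⟨e, he, hmax⟩ := exists_max_image ({e : S.Pair | SameBranch f e ∧ e.chk < f.chk})
    Pair.chk ⟨g, by simp [hg, hlt]⟩
  simp only [mem_filter, mem_univ, true_and] at he hmax
  refine ⟨e, ⟨he.1.1.symm, he.1.2.symm⟩, he.2, fun g hg hlt => ?_⟩
  exact absurd (hmax g ⟨⟨he.1.1.trans hg.1, he.1.2.trans hg.2⟩, hlt.2⟩) hlt.1.not_ge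

theorem exists_checkNext_left {f : S.Pair} (h : ∃ g : S.Pair, g.chk = f.chk ∧ g.qubit < f.qubit) :
    ∃ e, CheckNext e f := by
  classical
  obtain ⟨g, hg, hlt⟩ := h
  obtain ⟨e, he, hmax⟩ := exists_max_image ({e : S.Pair | e.chk = f.chk ∧ e.qubit < f.qubit})
    Pair.qubit ⟨g, by simp [hg, hlt]⟩
  simp only [mem_filter, mem_univ, true_and] at he hmax
  refine ⟨e, he.1, he.2, fun g hg hlt => ?_⟩
  exact absurd (hmax g ⟨hg.trans he.1, hlt.2⟩) hlt.1.not_ge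

theorem exists_checkNext_right {e : S.Pair} (h : ∃ g : S.Pair, g.chk = e.chk ∧ e.qubit < g.qubit) :
    ∃ f, CheckNext e f := by
  classical
  obtain ⟨g, hg, hlt⟩ := h
  obtain ⟨f, hf, hmin⟩ := exists_min_image ({f : S.Pair | f.chk = e.chk ∧ e.qubit < f.qubit})
    Pair.qubit ⟨g, by simp [hg, hlt]⟩
  simp only [mem_filter, mem_univ, true_and] at hf hmin
  refine ⟨f, hf.1.symm, hf.2, fun g hg hlt => ?_⟩
  exact absurd (hmin g ⟨hg, hlt.1⟩) hlt.2.not_ge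

theorem Pair.initialOp_of_first {f : S.Pair}
    (h : ∀ g : S.Pair, g.chk = f.chk → f.qubit ≤ g.qubit) : f.initialOp = f.op := by
  funext q
  rw [initialOp, op]
  rcases eq_or_ne q f.qubit with rfl | hq
  · rw [if_pos le_rfl, Pi.single_eq_same]
    rfl
  · rw [Pi.single_eq_of_ne hq]
    split_ifs with hle
    · by_contra h0
      exact hq (le_antisymm hle (h ⟨(q, f.chk), h0⟩ rfl))
    · rfl

/-- No element of the support lies between consecutive ones, so exactly one factor is added. The
junction checks follow this recursion. -/
theorem Pair.initialOp_of_checkNext {e f : S.Pair} (h : CheckNext e f) :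
    f.initialOp = f.op + e.initialOp := by
  funext q
  rw [Pi.add_apply, initialOp, op, initialOp, h.1]
  rcases eq_or_ne q f.qubit with rfl | hq
  · rw [if_pos le_rfl, Pi.single_eq_same, if_neg h.2.1.not_ge, add_zero]
    rfl
  · rw [Pi.single_eq_of_ne hq, zero_add]
    by_cases h1 : q ≤ e.qubit
    · rw [if_pos h1, if_pos (h1.trans h.2.1.le)]
    · rw [if_neg h1]
      split_ifs with h2
      · by_contra h0
        exact h.2.2 ⟨(q, f.chk), h0⟩ h.1.symm ⟨not_le.1 h1, lt_of_le_of_ne h2 hq⟩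
      · rfl

theorem Pair.initialOp_of_last {e : S.Pair}
    (h : ∀ g : S.Pair, g.chk = e.chk → g.qubit ≤ e.qubit) : e.initialOp = S.check e.chk := by
  funext q
  rw [initialOp]
  split_ifs with hq
  · rfl
  · by_contra h0
    exact hq (h ⟨(q, e.chk), Ne.symm h0⟩ rfl)

end StabilizerCode

namespace Run

variable {n r : ℕ} {S : StabilizerCode n r} {D c w δ : ℕ} (R : Run S D c w δ)

theorem sum_qubit {M : Type*} [AddCommMonoid M] (F : R.Qubit → M) :
    ∑ u, F u = (∑ q, F (.data q) + ∑ e, F (.copy e)) +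
      (∑ a : Σ e : S.Pair, Fin (R.numVerts e), F (.wire a.1 a.2) + ∑ l, F (.link l)) := by
  rw [← R.qubitEquiv.sum_comp, Fintype.sum_sum_type, Fintype.sum_sum_type, Fintype.sum_sum_type]
  rfl

/-- The operator on the input qubits that is equivalent to `Z` on an auxiliary qubit. -/
def pushZ : R.Qubit → Pauli (Fin n)
  | .data _ => 0
  | .copy e => e.op
  | .wire e _ => e.op
  | .link l => l.1.1.initialOp

/-- Moves an operator to the data qubits, by gauge operators. -/
noncomputable def push : Pauli R.Qubit →ₗ[ZMod 2] Pauli (Fin n) where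
  toFun a := (fun q => a (.data q)) + ∑ u, (a u).2 • R.pushZ u
  map_add' a b := by
    simp only [Pi.add_apply, Prod.snd_add, add_smul, sum_add_distrib]
    exact add_add_add_comm (fun q => a (.data q)) (fun q => b (.data q)) _ _
  map_smul' k a := by
    simp only [RingHom.id_apply, smul_add, smul_sum, smul_smul]
    rfl

theorem push_apply (a : Pauli R.Qubit) :
    R.push a = (fun q => a (.data q)) + ∑ u, (a u).2 • R.pushZ u := rfl

/-- The operators on the data qubits. -/
def embed : Pauli (Fin n) →ₗ[ZMod 2] Pauli R.Qubit where
  toFun a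
    | .data q => a q
    | _ => 0
  map_add' a b := by
    funext u
    cases u <;> rfl
  map_smul' k a := by
    funext u
    cases u <;> rfl

/-- The extension of an operator on the input qubits to an operator that commutes with all
gauge checks which are trivial after pushing them to the data qubits. -/
def bare (a : Pauli (Fin n)) : Pauli R.Qubit
  | .data q => a q
  | u => (commutator a (R.pushZ u), 0)

/-- The condition is asked only where `pushZ` is nonzero, so `a` may act arbitrarily on data qubits.
-/
theorem push_eq_of_snd_eq_zero {a : Pauli R.Qubit}
    (h : ∀ u, R.pushZ u ≠ 0 → (a u).2 = 0) : R.push a = fun q => a (.data q) := by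
  rw [push_apply, sum_eq_zero, add_zero]
  intro u _
  by_cases hu : R.pushZ u = 0
  · rw [hu, smul_zero]
  · rw [h u hu, zero_smul]

theorem push_bare (a : Pauli (Fin n)) : R.push (R.bare a) = a := by
  rw [push_eq_of_snd_eq_zero]
  · rfl
  · rintro (q | e | ⟨e, t⟩ | l) h
    · exact absurd rfl h
    all_goals rfl

/-- On an auxiliary qubit `u`, `bare a` carries `X` exactly when `a` anticommutes with `pushZ u`, so
it sees `Z` on `u` as `a` sees `pushZ u`. The `X` part of `b` on auxiliary qubits is invisible to
both sides. -/
theorem commutator_bare (a : Pauli (Fin n)) (b : Pauli R.Qubit) :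
    commutator (R.bare a) b = commutator a (R.push b) := by
  rw [← commutatorLinear_apply a, push_apply, map_add, map_sum]
  simp only [map_smul, commutatorLinear_apply, smul_eq_mul]
  rw [commutator, R.sum_qubit, R.sum_qubit]
  simp only [bare, pushZ, zero_mul, add_zero, mul_comm]
  simp only [commutator, Pi.zero_apply, Prod.fst_zero, Prod.snd_zero, mul_zero, add_zero,
    sum_const_zero, zero_add]
  ring

theorem commutator_embed (a : Pauli R.Qubit) (b : Pauli (Fin n)) :
    commutator a (R.embed b) = commutator (fun q => a (.data q)) b := by
  rw [commutator, R.sum_qubit]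
  simp [embed, commutator]

/-- The operator `Z` on a single qubit. -/
def singleZ [DecidableEq R.Qubit] (u : R.Qubit) : Pauli R.Qubit := Pi.single u pZ

variable [DecidableEq R.Qubit]

theorem push_singleZ {u : R.Qubit} (hu : ∀ q, u ≠ .data q) : R.push (R.singleZ u) = R.pushZ u := by
  have : (fun q => R.singleZ u (.data q)) = 0 :=
    funext fun q => Pi.single_eq_of_ne (hu q).symm _
  rw [push_apply, this, zero_add, sum_eq_single u]
  · rw [singleZ, Pi.single_eq_same]
    exact one_smul _ _
  · intro v _ hv
    rw [singleZ, Pi.single_eq_of_ne hv]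
    exact zero_smul _ _
  · intro h
    exact absurd (mem_univ u) h

theorem push_single_data (q : Fin n) (p : ZMod 2 × ZMod 2) :
    R.push (Pi.single (.data q) p) = Pi.single q p := by
  rw [push_eq_of_snd_eq_zero]
  · funext q'
    rcases eq_or_ne q' q with rfl | h
    · rw [Pi.single_eq_same, Pi.single_eq_same]
    · rw [Pi.single_eq_of_ne h, Pi.single_eq_of_ne (by simpa using h)]
  · rintro u hu
    rw [Pi.single_eq_of_ne]
    · rfl
    · rintro rfl
      exact hu rfl

theorem embed_single (q : Fin n) (p : ZMod 2 × ZMod 2) :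
    R.embed (Pi.single q p) = Pi.single (.data q) p := by
  funext u
  rcases u with q' | e | ⟨e, t⟩ | l
  · rcases eq_or_ne q' q with rfl | h
    · rw [Pi.single_eq_same]
      exact Pi.single_eq_same _ _
    · rw [Pi.single_eq_of_ne (by simpa using h)]
      exact Pi.single_eq_of_ne h _
  all_goals
    refine Eq.symm (Pi.single_eq_of_ne ?_ _)
    simp

theorem copyCheck_of_isBranchStart {f : S.Pair} (h : IsBranchStart f) :
    R.copyCheck f = Pi.single (.data f.qubit) f.pauli + R.singleZ (.copy f) := by
  have hn : ∀ e, ¬ BranchNext e f := fun e he =>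
    (h e ⟨he.1.1.symm, he.1.2.symm⟩).not_gt he.2.1
  classical
  funext u
  rcases u with q | e | ⟨e, t⟩ | l <;> simp [copyCheck, singleZ, Pi.single_apply, h, hn]

theorem copyCheck_of_branchNext {e f : S.Pair} (h : BranchNext e f) :
    R.copyCheck f = R.singleZ (.copy e) + R.singleZ (.copy f) := by
  have hs : ¬ IsBranchStart f := fun hs =>
    (hs e ⟨h.1.1.symm, h.1.2.symm⟩).not_gt h.2.1
  have hn : ∀ e', BranchNext e' f ↔ e' = e := fun e' =>
    ⟨fun h' => h'.left_unique h, fun h' => h' ▸ h⟩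
  have hne : e ≠ f := by
    rintro rfl
    exact h.2.1.false
  classical
  funext u
  rcases u with q | e' | ⟨e', t⟩ | l <;> simp [copyCheck, singleZ, Pi.single_apply, hs, hn]
  by_cases h1 : e' = f
  · subst h1
    simp [hne.symm]
  · simp [h1]

theorem wireCheck_zero (f : S.Pair) :
    R.wireCheck f ⟨0, Nat.succ_pos _⟩ =
      R.singleZ (.copy f) + R.singleZ (.wire f ⟨0, Nat.succ_pos _⟩) := by
  classical
  funext u
  rcases u with q | e | ⟨e, t⟩ | l <;> simp [wireCheck, singleZ, Pi.single_apply]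
  rcases eq_or_ne e f with rfl | h
  · simp [Fin.ext_iff]
  · simp [h]

theorem wireCheck_succ (f : S.Pair) (t : ℕ) (ht : t + 1 < R.numVerts f) :
    R.wireCheck f ⟨t + 1, ht⟩ = R.singleZ (.wire f ⟨t, t.lt_succ_self.trans ht⟩) +
      R.singleZ (.wire f ⟨t + 1, ht⟩) := by
  classical
  funext u
  rcases u with q | e | ⟨e, u⟩ | l <;> simp [wireCheck, singleZ, Pi.single_apply]
  rcases eq_or_ne e f with rfl | h
  · by_cases h1 : (u : ℕ) = t + 1
    · simp [Fin.ext_iff, h1]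
    · simp [Fin.ext_iff, h1]
  · simp [h]

-- Each sum has at most one term; empty sums stand for the links omitted at the two ends of the
-- support.
open Classical in
theorem junctionCheck_eq (f : S.Pair) :
    R.junctionCheck f =
      R.singleZ (.wire f ⟨R.numVerts f - 1, Nat.sub_lt (Nat.succ_pos _) one_pos⟩) +
      ∑ l : Link S with l.1.1 = f, R.singleZ (.link l) +
      ∑ l : Link S with l.1.2 = f, R.singleZ (.link l) := by
  have hpos : 0 < R.numVerts f := Nat.succ_pos _
  funext u
  simp only [Pi.add_apply, Finset.sum_apply]
  rcases u with q | e | ⟨e, u⟩ | l <;> simp [junctionCheck, singleZ, Pi.single_apply]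
  · rcases eq_or_ne e f with rfl | h
    · simp only [true_and, Fin.ext_iff, heq_eq_eq]
      congr 1
      apply propext
      omega
    · simp [h]
  · have hne : l.1.1 ≠ l.1.2 := fun h => (h ▸ l.2.2.1).false
    by_cases h1 : l.1.1 = f
    · have h2 : l.1.2 ≠ f := fun h2 => hne (h1.trans h2.symm)
      simp [h1, h2]
    · simp [h1]

end Run

end WireCode

/-! ### The wire code reduces to the input code -/

namespace WireCode

open Finset StabilizerCode

namespace Run

variable {n r : ℕ} {S : StabilizerCode n r} {D c w δ : ℕ} (R : Run S D c w δ)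

open Classical in
theorem filter_link_fst_eq (l : Link S) : ({l' | l'.1.1 = l.1.1} : Finset (Link S)) = {l} := by
  ext l'
  rw [mem_filter, mem_singleton]
  constructor
  · rintro ⟨-, h⟩
    have h' : l'.1.2 = l.1.2 := CheckNext.right_unique (h ▸ l'.2) l.2
    exact Subtype.ext (Prod.ext h h')
  · rintro rfl
    exact ⟨mem_univ _, rfl⟩

open Classical in
theorem filter_link_snd_eq (l : Link S) : ({l' | l'.1.2 = l.1.2} : Finset (Link S)) = {l} := by
  ext l'
  rw [mem_filter, mem_singleton]
  constructor
  · rintro ⟨-, h⟩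
    have h' : l'.1.1 = l.1.1 := CheckNext.left_unique (h ▸ l'.2) l.2
    exact Subtype.ext (Prod.ext h' h)
  · rintro rfl
    exact ⟨mem_univ _, rfl⟩

theorem push_singleX (v : R.Qubit) (hv : ∀ q, v ≠ .data q) : R.push (R.singleX v) = 0 := by
  rw [push_eq_of_snd_eq_zero]
  · funext q
    exact if_neg (hv q).symm
  · intro u _
    rw [singleX]
    split_ifs <;> rfl

theorem push_copyCheck (f : S.Pair) : R.push (R.copyCheck f) = 0 := by
  classical
  by_cases h : IsBranchStart f
  · rw [R.copyCheck_of_isBranchStart h, map_add, push_single_data, push_singleZ _ (by simp)]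
    exact ZModModule.add_self _
  · obtain ⟨e, he⟩ := exists_branchNext h
    have : e.op = f.op := by rw [Pair.op, Pair.op, he.1.1, he.1.2]
    rw [R.copyCheck_of_branchNext he, map_add, push_singleZ _ (by simp), push_singleZ _ (by simp),
      pushZ, pushZ, this]
    exact ZModModule.add_self _

theorem push_wireCheck (f : S.Pair) (t : Fin (R.numVerts f)) : R.push (R.wireCheck f t) = 0 := by
  classical
  obtain ⟨t, ht⟩ := t
  cases t with
  | zero =>
    rw [wireCheck_zero, map_add, push_singleZ _ (by simp), push_singleZ _ (by simp)]
    exact ZModModule.add_self _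
  | succ t =>
    rw [wireCheck_succ, map_add, push_singleZ _ (by simp), push_singleZ _ (by simp)]
    exact ZModModule.add_self _

-- The end of the route contributes `f.op` and the incoming link the part of the check before it,
-- together `f.initialOp`. An outgoing link contributes `f.initialOp` once more, so the result
-- vanishes unless `f` is last.
open Classical in
theorem push_junctionCheck_eq (f : S.Pair) :
    R.push (R.junctionCheck f) = (∑ l : Link S with l.1.1 = f, f.initialOp) + f.initialOp := by
  have h1 : ∑ l : Link S with l.1.1 = f, R.push (R.singleZ (.link l)) =
      ∑ l : Link S with l.1.1 = f, f.initialOp :=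
    sum_congr rfl fun l hl => by
      rw [push_singleZ _ (by simp), pushZ, (mem_filter.1 hl).2]
  have h2 : f.op + ∑ l : Link S with l.1.2 = f, R.push (R.singleZ (.link l)) = f.initialOp := by
    by_cases h : ∃ g : S.Pair, g.chk = f.chk ∧ g.qubit < f.qubit
    · obtain ⟨e, he⟩ := exists_checkNext_left h
      obtain ⟨l, rfl, rfl⟩ : ∃ l : Link S, l.1.1 = e ∧ l.1.2 = f := ⟨⟨(e, f), he⟩, rfl, rfl⟩
      rw [filter_link_snd_eq, sum_singleton, push_singleZ _ (by simp),
        Pair.initialOp_of_checkNext he, pushZ]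
    · push Not at h
      rw [Pair.initialOp_of_first h, filter_eq_empty_iff.2, sum_empty, add_zero]
      rintro ⟨⟨e, f'⟩, hl⟩ - rfl
      exact (h e hl.1).not_gt hl.2.1
  rw [junctionCheck_eq, map_add, map_add, map_sum, map_sum, h1, push_singleZ _ (by simp), pushZ,
    add_right_comm, h2, add_comm]

theorem push_junctionCheck_of_link (l : Link S) : R.push (R.junctionCheck l.1.1) = 0 := by
  classical
  rw [push_junctionCheck_eq, filter_link_fst_eq, sum_singleton]
  exact ZModModule.add_self _

theorem push_junctionCheck_of_last {e : S.Pair}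
    (h : ∀ g : S.Pair, g.chk = e.chk → g.qubit ≤ e.qubit) :
    R.push (R.junctionCheck e) = S.check e.chk := by
  classical
  rw [push_junctionCheck_eq, filter_eq_empty_iff.2, sum_empty, zero_add,
    Pair.initialOp_of_last h]
  rintro ⟨⟨e', f⟩, hl⟩ - rfl
  exact (h f hl.1.symm).not_gt hl.2.1

theorem push_gaugeCheck_mem (i : R.CheckIndex) :
    R.push (R.gaugeCheck i) ∈ gaugeGroup S.check := by
  rcases i with (f | ⟨f, t⟩ | f) | (e | ⟨e, t⟩ | l)
  · exact (R.push_copyCheck f).symm ▸ Submodule.zero_mem _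
  · exact (R.push_wireCheck f t).symm ▸ Submodule.zero_mem _
  · change R.push (R.junctionCheck f) ∈ _
    by_cases h : ∃ g : S.Pair, g.chk = f.chk ∧ f.qubit < g.qubit
    · obtain ⟨g, hg⟩ := exists_checkNext_right h
      rw [R.push_junctionCheck_of_link ⟨(f, g), hg⟩]
      exact Submodule.zero_mem _
    · push Not at h
      rw [R.push_junctionCheck_of_last h]
      exact Submodule.subset_span ⟨_, rfl⟩
  all_goals
    refine (R.push_singleX _ ?_).symm ▸ Submodule.zero_mem _
    simp

/-- The operators that differ by a gauge operator from the result of moving them to the data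
qubits. -/
noncomputable def pushable : Submodule (ZMod 2) (Pauli R.Qubit) :=
  (gaugeGroup R.gaugeCheck).comap (LinearMap.id - R.embed.comp R.push)

theorem mem_pushable {a : Pauli R.Qubit} :
    a ∈ R.pushable ↔ a - R.embed (R.push a) ∈ gaugeGroup R.gaugeCheck := Iff.rfl

theorem gaugeCheck_mem_pushable {i : R.CheckIndex} (h : R.push (R.gaugeCheck i) = 0) :
    R.gaugeCheck i ∈ R.pushable := by
  rw [mem_pushable, h, map_zero, sub_zero]
  exact Submodule.subset_span ⟨i, rfl⟩

section SingleZ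

variable [DecidableEq R.Qubit]

theorem single_data_mem_pushable (q : Fin n) (p : ZMod 2 × ZMod 2) :
    Pi.single (.data q) p ∈ R.pushable := by
  rw [mem_pushable, push_single_data, embed_single, sub_self]
  exact Submodule.zero_mem _

/-- Induction along the branch: the branch check at `f` pushes to zero, hence is pushable, and its
other factor is a data operator or `Z` on the preceding copy qubit. The same propagation runs along
routes and then along links. -/
theorem singleZ_copy_mem_pushable (f : S.Pair) : R.singleZ (.copy f) ∈ R.pushable := by
  induction h : f.chk using WellFoundedLT.induction generalizing f with
  | ind s ih =>
    have hf := R.gaugeCheck_mem_pushable (i := .inl (.inl f)) (R.push_copyCheck f)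
    change R.copyCheck f ∈ _ at hf
    by_cases hs : IsBranchStart f
    · rw [R.copyCheck_of_isBranchStart hs] at hf
      exact (Submodule.add_mem_iff_right _ (R.single_data_mem_pushable _ _)).1 hf
    · obtain ⟨e, he⟩ := exists_branchNext hs
      rw [R.copyCheck_of_branchNext he] at hf
      exact (Submodule.add_mem_iff_right _ (ih e.chk (h ▸ he.2.1) e rfl)).1 hf

theorem singleZ_wire_mem_pushable (f : S.Pair) (t : Fin (R.numVerts f)) :
    R.singleZ (.wire f t) ∈ R.pushable := by
  obtain ⟨t, ht⟩ := t
  have hf := R.gaugeCheck_mem_pushable (i := .inl (.inr (.inl ⟨f, ⟨t, ht⟩⟩)))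
    (R.push_wireCheck f _)
  change R.wireCheck f ⟨t, ht⟩ ∈ _ at hf
  induction t with
  | zero =>
    rw [wireCheck_zero] at hf
    exact (Submodule.add_mem_iff_right _ (R.singleZ_copy_mem_pushable f)).1 hf
  | succ t ih =>
    rw [wireCheck_succ] at hf
    exact (Submodule.add_mem_iff_right _ (ih _ (R.gaugeCheck_mem_pushable
      (i := .inl (.inr (.inl ⟨f, ⟨t, _⟩⟩))) (R.push_wireCheck f _)))).1 hf

theorem singleZ_link_mem_pushable (l : Link S) : R.singleZ (.link l) ∈ R.pushable := by
  classical
  induction h : l.1.1.qubit using WellFoundedLT.induction generalizing l with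
  | ind q ih =>
    -- In the junction check at the first pair of `l`, the wire factor is already known and an
    -- incoming link belongs to a smaller qubit, so only `Z` on `l` is new.
    have hf := R.gaugeCheck_mem_pushable (i := .inl (.inr (.inr l.1.1)))
      (R.push_junctionCheck_of_link l)
    change R.junctionCheck l.1.1 ∈ _ at hf
    have h2 : ∑ l' : Link S with l'.1.2 = l.1.1, R.singleZ (.link l') ∈ R.pushable := by
      refine Submodule.sum_mem _ fun l' hl' => ih l'.1.1.qubit ?_ l' rfl
      rw [← h, ← (mem_filter.1 hl').2]
      exact l'.2.2.1
    rw [junctionCheck_eq, filter_link_fst_eq, sum_singleton] at hf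
    exact (Submodule.add_mem_iff_right _ (R.singleZ_wire_mem_pushable _ _)).1
      ((Submodule.add_mem_iff_left _ h2).1 hf)

end SingleZ

/-- Single-qubit operators suffice: those on data qubits are left unchanged by pushing, and on
auxiliary qubits `X` is a gauge check that pushes to zero while `Z` has just been treated. -/
theorem pushable_eq_top : R.pushable = ⊤ := by
  classical
  refine Submodule.eq_top_iff'.2 fun a => ?_
  have key : ∀ (u : R.Qubit), R.singleX u ∈ R.pushable → R.singleZ u ∈ R.pushable → ∀ p,
      Pi.single u p ∈ R.pushable := by
    intro u hX hZ p
    have : (Pi.single u p : Pauli R.Qubit) = p.1 • R.singleX u + p.2 • R.singleZ u := by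
      funext v
      by_cases h : v = u
      · subst h
        simp [singleX, singleZ, pX, pZ]
      · simp [singleX, singleZ, h]
    rw [this]
    exact Submodule.add_mem _ (Submodule.smul_mem _ _ hX) (Submodule.smul_mem _ _ hZ)
  rw [← univ_sum_single a]
  refine Submodule.sum_mem _ fun u _ => ?_
  rcases u with q | e | ⟨e, t⟩ | l
  · exact R.single_data_mem_pushable _ _
  · exact key _ (R.gaugeCheck_mem_pushable (i := .inr (.inl e)) (R.push_singleX _ (by simp)))
      (R.singleZ_copy_mem_pushable e) _
  · exact key _ (R.gaugeCheck_mem_pushable (i := .inr (.inr (.inl ⟨e, t⟩)))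
      (R.push_singleX _ (by simp))) (R.singleZ_wire_mem_pushable e t) _
  · exact key _ (R.gaugeCheck_mem_pushable (i := .inr (.inr (.inr l)))
      (R.push_singleX _ (by simp))) (R.singleZ_link_mem_pushable l) _

theorem sub_embed_push_mem (a : Pauli R.Qubit) :
    a - R.embed (R.push a) ∈ gaugeGroup R.gaugeCheck := by
  rw [← mem_pushable, pushable_eq_top]
  exact Submodule.mem_top

/-- The junction check at the last pair of `s` pushes to `S.check s`, and pushing changes it by a
gauge operator only. A last pair exists because `s` is not the identity. -/
theorem embed_check_mem (s : Fin r) : R.embed (S.check s) ∈ gaugeGroup R.gaugeCheck := by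
  classical
  obtain ⟨q, hq⟩ := Function.ne_iff.1 (S.nontrivial s)
  obtain ⟨e, he, hmax⟩ := exists_max_image ({e : S.Pair | e.chk = s}) Pair.qubit
    ⟨⟨(q, s), hq⟩, mem_filter.2 ⟨mem_univ _, rfl⟩⟩
  obtain rfl : e.chk = s := (mem_filter.1 he).2
  have h1 := R.sub_embed_push_mem (R.junctionCheck e)
  rw [R.push_junctionCheck_of_last fun g hg => hmax g (mem_filter.2 ⟨mem_univ _, hg⟩)] at h1
  have h2 : R.junctionCheck e ∈ gaugeGroup R.gaugeCheck :=
    Submodule.subset_span ⟨.inl (.inr (.inr e)), rfl⟩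
  exact (Submodule.sub_mem_iff_right _ h2).1 h1

theorem commutator_singleX (a : Pauli R.Qubit) (u : R.Qubit) :
    commutator a (R.singleX u) = (a u).2 := by
  rw [commutator, sum_eq_single u]
  · simp [singleX, pX]
  · intro v _ hv
    simp [singleX, hv]
  · intro h
    exact absurd (mem_univ u) h

/-- Commuting with the gauge check `X` on each auxiliary qubit excludes `Z` there, so nothing is
moved to the data qubits. -/
theorem push_eq_of_mem_normalizer {a : Pauli R.Qubit}
    (ha : a ∈ normalizer (gaugeGroup R.gaugeCheck)) : R.push a = fun q => a (.data q) := by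
  refine R.push_eq_of_snd_eq_zero fun u hu => ?_
  rw [← commutator_singleX]
  refine ha _ (Submodule.subset_span ?_)
  rcases u with q | e | ⟨e, t⟩ | l
  · exact absurd rfl hu
  · exact ⟨.inr (.inl e), rfl⟩
  · exact ⟨.inr (.inr (.inl ⟨e, t⟩)), rfl⟩
  · exact ⟨.inr (.inr (.inr l)), rfl⟩

/-- The wire code reduces to the input code. -/
noncomputable def reduction : Reduction R.gaugeCheck S.check where
  reduce := R.push
  embed := R.embed
  bare := R.bare
  sub_embed_mem := R.sub_embed_push_mem
  reduce_check_mem := R.push_gaugeCheck_mem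
  embed_check_mem := R.embed_check_mem
  commutator_bare := R.commutator_bare
  reduce_bare := R.push_bare
  commutator_reduce a ha b := by rw [R.push_eq_of_mem_normalizer ha, commutator_embed]

theorem weight_pushZ_le (hS : S.IsLDPC w δ) (u : R.Qubit) : weight (R.pushZ u) ≤ w + 1 := by
  have hop : ∀ e : S.Pair, weight e.op ≤ w + 1 := by
    intro e
    refine (card_le_card (t := {e.qubit}) fun q hq => ?_).trans
      ((card_singleton e.qubit).le.trans (Nat.le_add_left 1 w))
    rw [mem_singleton]
    by_contra h
    exact (mem_filter.1 hq).2 (Pi.single_eq_of_ne h _)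
  rcases u with q | e | ⟨e, t⟩ | l
  · simp [weight, pushZ]
  · exact hop e
  · exact hop e
  · refine le_trans (card_le_card fun q hq => ?_) ((hS.1 l.1.1.chk).trans w.le_succ)
    refine mem_filter.2 ⟨mem_univ _, fun h => (mem_filter.1 hq).2 ?_⟩
    rw [pushZ, Pair.initialOp, h, ite_self]

/-- A data qubit contributes only to itself and an auxiliary one only to the support of its `pushZ`,
which lies in a single qubit or in the support of one check. -/
theorem weight_push_le (hS : S.IsLDPC w δ) (a : Pauli R.Qubit) :
    weight (R.push a) ≤ (w + 1) * weight a := by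
  classical
  let T : R.Qubit → Finset (Fin n) := fun u => match u with
    | .data q => {q}
    | u => {q | R.pushZ u q ≠ 0}
  have hT : ∀ u, #(T u) ≤ w + 1 := by
    rintro (q | e | ⟨e, t⟩ | l)
    · simp [T]
    all_goals exact R.weight_pushZ_le hS _
  have hsub : ({q | R.push a q ≠ 0} : Finset (Fin n)) ⊆
      ({u | a u ≠ 0} : Finset R.Qubit).biUnion T := by
    intro q hq
    rw [mem_biUnion]
    by_contra! h
    refine (mem_filter.1 hq).2 ?_
    rw [push_apply, Pi.add_apply, Finset.sum_apply]
    have h1 : a (.data q) = 0 := by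
      by_contra h1
      exact h (.data q) (mem_filter.2 ⟨mem_univ _, h1⟩) (mem_singleton_self q)
    rw [h1, zero_add]
    refine sum_eq_zero fun u _ => ?_
    rw [Pi.smul_apply]
    by_cases hu : a u = 0
    · rw [hu]
      exact zero_smul _ _
    · have h2 := h u (mem_filter.2 ⟨mem_univ _, hu⟩)
      have h3 : R.pushZ u q = 0 := by
        rcases u with q | e | ⟨e, t⟩ | l
        · rfl
        all_goals
          by_contra h3
          exact h2 (mem_filter.2 ⟨mem_univ _, h3⟩)
      rw [h3, smul_zero]
  rw [mul_comm]
  exact (card_le_card hsub).trans (card_biUnion_le_card_mul _ _ _ fun u _ => hT u)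

end Run

end WireCode

theorem mainTheorem3 (D : ℕ) (hD : 3 ≤ D) :
    ∃ c : ℕ, 0 < c ∧ ∀ w δ : ℕ, ∃ A B ρ : ℕ,
      ∀ (n r : ℕ) (S : WireCode.StabilizerCode n r), S.IsLDPC w δ →
        Nonempty (WireCode.Run S D c w δ) ∧
        ∀ R : WireCode.Run S D c w δ,
          (Fintype.card R.Qubit : ℝ) ≤ A * (c * (n : ℝ) ^ ((D : ℝ) / ((D : ℝ) - 1))) ∧
          WireCode.numLogicalQubits R.gaugeCheck = WireCode.numLogicalQubits S.check ∧
          WireCode.distance S.check ≤ B * WireCode.distance R.gaugeCheck ∧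
          WireCode.IsLocalOn (WireCode.lattice D) ρ R.pos R.gaugeCheck ∧
          (∀ i, WireCode.weight (R.gaugeCheck i) ≤ 3) ∧
          (∀ v, WireCode.degree R.gaugeCheck v ≤ 3) := by
  obtain ⟨d, rfl⟩ : ∃ d, D = d + 1 := ⟨D - 1, by omega⟩
  have hd : 2 ≤ d := by omega
  have hc : 0 < 6 * d := by omega
  -- `6 d` is the number of layers per unit of `m` used by the routing, and `w + 1` is the weight
  -- growth of `push`; `A` and `ρ` are read off from `card_qubit_le` and `isLocalOn`.
  refine ⟨6 * d, hc, fun w δ => ⟨_, w + 1, _, fun n r S hS => ⟨WireCode.nonempty_run hS hd,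
    fun R => ⟨R.card_qubit_le hS hd hc, R.reduction.numLogicalQubits_eq,
      R.reduction.distance_le w.succ_ne_zero (R.weight_push_le hS),
      R.isLocalOn hS (by omega) hc, R.weight_gaugeCheck_le, R.degree_le⟩⟩⟩⟩
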